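/- Let $\mathcal Z$ be a (commutative, unital) integral domain, $\xi\in\mathcal Z^\times$, $n\ge 1$, $\ell\ge 0$ and $\boldsymbol\kappa=(\kappa_1,\dots,\kappa_\ell)\in\mathbb Z^\ell$; put $\boldsymbol\kappa'=(-\kappa_\ell,\dots,-\kappa_1)$. For $k\in\mathbb Z$ let $[k]_\xi=1+\xi+\dots+\xi^{k-1}$ if $k\ge 0$ and $[k]_\xi=-(\xi^{-1}+\xi^{-2}+\dots+\xi^{k})$ if $k<0$. Let $\mathscr H_{n,\ell}(\mathcal Z,\xi,\boldsymbol\kappa)$ be the cyclotomic Hecke algebra, that is, the unital associative $\mathcal Z$-algebra generated by $L_1,\dots,L_n,T_1,\dots,T_{n-1}$ subject to the relations $$\prod_{i=1}^{\ell}(L_1-[\kappa_i]_\xi)=0,\qquad (T_r+1)(T_r-\xi)=0,\qquad L_rL_s=L_sL_r,$$ $$T_rT_s=T_sT_r\ \text{ if } |r-s|>1,\qquad T_rT_{r+1}T_r=T_{r+1}T_rT_{r+1},$$ $$T_rL_s=L_sT_r\ \text{ if } s\ne r,r+1,\qquad L_{r+1}(T_r-\xi+1)=T_rL_r+1,$$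 for all indices for which they make sense. Put $\widetilde L_1=(\xi-1)L_1+1$. The elements $T_1,\dots,T_{n-1}$ and $\widetilde L_1$ are invertible in each of these algebras. There is a unique homomorphism of unital $\mathcal Z$-algebras $$\#:\mathscr H_{n,\ell}(\mathcal Z,\xi,\boldsymbol\kappa)\longrightarrow\mathscr H_{n,\ell}(\mathcal Z,\xi,\boldsymbol\kappa')$$ such that $\#(T_i)=-\xi T_i^{-1}$ for $i=1,\dots,n-1$ and such that $\#(L_1)=-L_1$ if $\xi=1$, while $\#(\widetilde L_1)=\widetilde L_1^{-1}$ if $\xi\ne 1$. If moreover $\boldsymbol\kappa=\boldsymbol\kappa'$, then $\#$ is an involution of $\mathscr H_{n,\ell}(\mathcal Z,\xi,\boldsymbol\kappa)$, i.e. $\#\circ\#=\mathrm{id}$. -/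

import Mathlib

/-- The quantum integer `[k]_ξ` for a unit `ξ`: it is `1 + ξ + ⋯ + ξ ^ (k - 1)` for `k ≥ 0` and
`-(ξ⁻¹ + ξ⁻² + ⋯ + ξ ^ k)` for `k < 0`. -/
def quantumInt {Z : Type*} [CommRing Z] (ξ : Zˣ) : ℤ → Z
  | Int.ofNat k => ∑ j ∈ Finset.range k, (ξ : Z) ^ j
  | Int.negSucc k => -∑ j ∈ Finset.range (k + 1), ((ξ⁻¹ : Zˣ) : Z) ^ (j + 1)

/-- The dual multicharge `κ' = (-κ_ℓ, …, -κ_1)` of `κ = (κ_1, …, κ_ℓ)`. -/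
def dualMulticharge {l : ℕ} (κ : Fin l → ℤ) : Fin l → ℤ := fun i => -κ i.rev

namespace CyclotomicHecke

/-- Symbols for the generators. Indices start at `0`: `L k` stands for `L_{k+1}` and
`T r` for `T_{r+1}`. -/
inductive Gen (n : ℕ) : Type
  | L (k : Fin n) : Gen n
  | T (r : Fin (n - 1)) : Gen n

/-- The index `r`, of `L_r`, for an index `r` of a generator `T_r`. -/
def idx {n : ℕ} (r : Fin (n - 1)) : Fin n := ⟨r.val, by omega⟩

/-- The index `r + 1`, of `L_{r+1}`, for an index `r` of a generator `T_r`. -/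
def idxSucc {n : ℕ} (r : Fin (n - 1)) : Fin n := ⟨r.val + 1, by omega⟩

section Relations

variable (Z : Type*) [CommRing Z] {n : ℕ}

/-- The generator `L_k` of the free algebra. -/
abbrev freeL (k : Fin n) : FreeAlgebra Z (Gen n) := FreeAlgebra.ι Z (Gen.L k)

/-- The generator `T_r` of the free algebra. -/
abbrev freeT (r : Fin (n - 1)) : FreeAlgebra Z (Gen n) := FreeAlgebra.ι Z (Gen.T r)

end Relations

/-- The defining relations of the cyclotomic Hecke algebra. -/
inductive Rel {Z : Type*} [CommRing Z] (n : ℕ) [NeZero n] {l : ℕ} (ξ : Zˣ) (κ : Fin l → ℤ) :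
    FreeAlgebra Z (Gen n) → FreeAlgebra Z (Gen n) → Prop
  | cyclotomic :
      Rel n ξ κ (List.ofFn fun i : Fin l =>
        freeL Z (0 : Fin n) - algebraMap Z _ (quantumInt ξ (κ i))).prod 0
  | quadratic (r : Fin (n - 1)) :
      Rel n ξ κ ((freeT Z r + 1) * (freeT Z r - algebraMap Z _ (ξ : Z))) 0
  | L_comm (r s : Fin n) :
      Rel n ξ κ (freeL Z r * freeL Z s) (freeL Z s * freeL Z r)
  | T_comm (r s : Fin (n - 1)) (h : 1 < |(r.val : ℤ) - (s.val : ℤ)|) :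
      Rel n ξ κ (freeT Z r * freeT Z s) (freeT Z s * freeT Z r)
  | braid (r s : Fin (n - 1)) (h : s.val = r.val + 1) :
      Rel n ξ κ (freeT Z r * freeT Z s * freeT Z r) (freeT Z s * freeT Z r * freeT Z s)
  | T_L_comm (r : Fin (n - 1)) (s : Fin n) (h : s ≠ idx r) (h' : s ≠ idxSucc r) :
      Rel n ξ κ (freeT Z r * freeL Z s) (freeL Z s * freeT Z r)
  | L_succ (r : Fin (n - 1)) :
      Rel n ξ κ (freeL Z (idxSucc r) * (freeT Z r - algebraMap Z _ (ξ : Z) + 1))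
        (freeT Z r * freeL Z (idx r) + 1)

end CyclotomicHecke

/-- The cyclotomic Hecke algebra `H_{n,ℓ}(Z, ξ, κ)`, given by generators and relations. -/
def CyclotomicHecke {Z : Type*} [CommRing Z] (n : ℕ) [NeZero n] {l : ℕ} (ξ : Zˣ)
    (κ : Fin l → ℤ) : Type _ :=
  RingQuot (CyclotomicHecke.Rel n ξ κ)

namespace CyclotomicHecke

section Elements

variable {Z : Type*} [CommRing Z] {n : ℕ} [NeZero n] {l : ℕ} (ξ : Zˣ) (κ : Fin l → ℤ)

noncomputable instance instRing : Ring (CyclotomicHecke n ξ κ) :=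
  inferInstanceAs (Ring (RingQuot (Rel n ξ κ)))

noncomputable instance instAlgebra : Algebra Z (CyclotomicHecke n ξ κ) :=
  inferInstanceAs (Algebra Z (RingQuot (Rel n ξ κ)))

/-- The quotient map from the free algebra onto the cyclotomic Hecke algebra. -/
noncomputable def mk : FreeAlgebra Z (Gen n) →ₐ[Z] CyclotomicHecke n ξ κ :=
  RingQuot.mkAlgHom Z (Rel n ξ κ)

theorem mk_rel {x y : FreeAlgebra Z (Gen n)} (h : Rel n ξ κ x y) : mk ξ κ x = mk ξ κ y :=
  RingQuot.mkAlgHom_rel Z h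

/-- The Jucys-Murphy element `L_{k+1}` of the cyclotomic Hecke algebra. -/
noncomputable def L (k : Fin n) : CyclotomicHecke n ξ κ := mk ξ κ (freeL Z k)

/-- The generator `T_{r+1}` of the cyclotomic Hecke algebra. -/
noncomputable def T (r : Fin (n - 1)) : CyclotomicHecke n ξ κ := mk ξ κ (freeT Z r)

/-- The affine Jucys-Murphy element `(ξ - 1) L_1 + 1`, often written `L_1` with a tilde. -/
noncomputable def affineL₁ : CyclotomicHecke n ξ κ := ((ξ : Z) - 1) • L ξ κ (0 : Fin n) + 1

theorem T_quadratic (r : Fin (n - 1)) :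
    (T ξ κ r + 1) * (T ξ κ r - algebraMap Z _ (ξ : Z)) = 0 := by
  have h := mk_rel ξ κ (Rel.quadratic (n := n) (ξ := ξ) (κ := κ) r)
  simpa only [T, map_mul, map_add, map_sub, map_one, map_zero, AlgHom.commutes] using h

theorem L_cyclotomic :
    (List.ofFn fun i : Fin l =>
      L ξ κ (0 : Fin n) - algebraMap Z _ (quantumInt ξ (κ i))).prod = 0 := by
  have h := mk_rel ξ κ (Rel.cyclotomic (n := n) (ξ := ξ) (κ := κ))
  rw [map_list_prod, List.map_ofFn, map_zero] at h
  rw [← h]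
  congr 2
  funext i
  simp only [Function.comp, map_sub, AlgHom.commutes, L]

theorem isUnit_T (r : Fin (n - 1)) : IsUnit (T ξ κ r) := by
  have hq := T_quadratic ξ κ r
  set t := T ξ κ r
  set a : CyclotomicHecke n ξ κ := algebraMap Z _ (ξ : Z) with ha
  set b : CyclotomicHecke n ξ κ := algebraMap Z _ ((ξ⁻¹ : Zˣ) : Z) with hb
  have hab : a * b = 1 := by rw [ha, hb, ← map_mul, Units.mul_inv, map_one]
  have hat : a * t = t * a := Algebra.commutes _ _
  have hbt : b * t = t * b := Algebra.commutes _ _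
  have h1 : t * (t - a + 1) = a := by
    have : (t + 1) * (t - a) = t * (t - a + 1) - a := by noncomm_ring
    rw [this] at hq
    exact sub_eq_zero.mp hq
  have h2 : (t - a + 1) * t = a := by
    refine Eq.trans ?_ h1
    have e : (t - a + 1) * t = t * t - a * t + t := by
      rw [add_mul, sub_mul, one_mul]
    rw [e, hat, mul_add, mul_sub, mul_one]
  refine isUnit_iff_exists.mpr ⟨(t - a + 1) * b, ?_, ?_⟩
  · rw [← mul_assoc, h1, hab]
  · rw [mul_assoc, hbt, ← mul_assoc, h2, hab]

theorem sub_one_mul_quantumInt (k : ℤ) :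
    ((ξ : Z) - 1) * quantumInt ξ k = ((ξ ^ k : Zˣ) : Z) - 1 := by
  cases k with
  | ofNat k =>
    simp only [quantumInt, Int.ofNat_eq_natCast, zpow_natCast, Units.val_pow_eq_pow_val]
    exact mul_geom_sum _ _
  | negSucc k =>
    simp only [quantumInt, zpow_negSucc]
    rw [← inv_pow, Units.val_pow_eq_pow_val]
    have h := mul_geom_sum ((ξ⁻¹ : Zˣ) : Z) (k + 1)
    have hu : (ξ : Z) * ((ξ⁻¹ : Zˣ) : Z) = 1 := Units.mul_inv ξ
    rw [← h]
    simp only [pow_succ', ← Finset.mul_sum]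
    linear_combination (-∑ i ∈ Finset.range (k + 1), ((ξ⁻¹ : Zˣ) : Z) ^ i) * hu

theorem isUnit_affineL₁ : IsUnit (affineL₁ ξ κ : CyclotomicHecke n ξ κ) := by
  classical
  let p : Polynomial Z := (List.ofFn fun i : Fin l =>
    (Polynomial.X - Polynomial.C (quantumInt ξ (κ i)))).prod
  let q : Polynomial Z := (List.ofFn fun i : Fin l =>
    (Polynomial.X - Polynomial.C ((ξ ^ κ i : Zˣ) : Z))).prod
  have hpq : q.comp (Polynomial.C ((ξ : Z) - 1) * Polynomial.X + 1)
      = Polynomial.C ((ξ : Z) - 1) ^ l * p := by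
    simp only [p, q, List.prod_ofFn, Polynomial.prod_comp]
    rw [← Fin.prod_const l, ← Finset.prod_mul_distrib]
    refine Finset.prod_congr rfl fun i _ => ?_
    have h := congrArg (Polynomial.C : Z → Polynomial Z) (sub_one_mul_quantumInt ξ (κ i))
    simp only [Polynomial.C_mul, Polynomial.C_sub, Polynomial.C_1] at h
    simp only [Polynomial.sub_comp, Polynomial.X_comp, Polynomial.C_comp, Polynomial.C_sub,
      Polynomial.C_1]
    linear_combination h
  have hp : Polynomial.aeval (L ξ κ (0 : Fin n)) p = 0 := by
    rw [← L_cyclotomic (n := n) ξ κ]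
    simp only [p, map_list_prod, List.map_ofFn]
    congr 2
    funext i
    simp
  have hq : Polynomial.aeval (affineL₁ ξ κ : CyclotomicHecke n ξ κ) q = 0 := by
    have h := congrArg (Polynomial.aeval (L ξ κ (0 : Fin n))) hpq
    rw [map_mul, hp, mul_zero, Polynomial.aeval_comp] at h
    rw [← h]
    congr 2
    simp [affineL₁, Algebra.smul_def]
  have hc : IsUnit (q.coeff 0) := by
    rw [Polynomial.coeff_zero_eq_eval_zero]
    simp only [q, List.prod_ofFn, Polynomial.eval_prod]
    refine IsUnit.prod_iff.mpr fun i _ => ?_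
    simp
  obtain ⟨u, hu⟩ := hc
  set x : CyclotomicHecke n ξ κ := affineL₁ ξ κ
  set d := Polynomial.aeval x q.divX
  have h0 : d * x + algebraMap Z _ (u : Z) = 0 := by
    rw [← hq]
    conv_rhs => rw [← Polynomial.divX_mul_X_add q]
    rw [map_add, map_mul, Polynomial.aeval_X, Polynomial.aeval_C, hu]
  have hdx : d * x = x * d := by
    have := congrArg (Polynomial.aeval x) (mul_comm q.divX Polynomial.X)
    simpa only [map_mul, Polynomial.aeval_X] using this
  set b : CyclotomicHecke n ξ κ := algebraMap Z _ ((u⁻¹ : Zˣ) : Z) with hb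
  have hub : algebraMap Z (CyclotomicHecke n ξ κ) (u : Z) * b = 1 := by
    rw [hb, ← map_mul, Units.mul_inv, map_one]
  have hbx : b * x = x * b := Algebra.commutes _ _
  have h1 : d * x = -algebraMap Z _ (u : Z) := eq_neg_of_add_eq_zero_left h0
  refine isUnit_iff_exists.mpr ⟨-(d * b), ?_, ?_⟩
  · rw [mul_neg, ← mul_assoc, ← hdx, h1, neg_mul, neg_neg, hub]
  · rw [neg_mul, mul_assoc, hbx, ← mul_assoc, h1, neg_mul, neg_neg, hub]

/-- `T_{r+1}` as a unit. -/
noncomputable def unitT (r : Fin (n - 1)) : (CyclotomicHecke n ξ κ)ˣ := (isUnit_T ξ κ r).unit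

/-- `(ξ - 1) L_1 + 1` as a unit. -/
noncomputable def unitAffineL₁ : (CyclotomicHecke n ξ κ)ˣ := (isUnit_affineL₁ ξ κ).unit

end Elements

/-- `f` sends every `T_i` to `-ξ T_i⁻¹`, and it sends `L_1` to `-L_1` if `ξ = 1`, and
`(ξ - 1) L_1 + 1` to its inverse if `ξ ≠ 1`. -/
structure IsHash {Z : Type*} [CommRing Z] {n : ℕ} [NeZero n] {l : ℕ} {ξ : Zˣ}
    {κ μ : Fin l → ℤ} (f : CyclotomicHecke n ξ κ →ₐ[Z] CyclotomicHecke n ξ μ) : Prop where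
  map_T : ∀ r : Fin (n - 1),
    f (T ξ κ r) = -((ξ : Z) • (((unitT ξ μ r)⁻¹ : (CyclotomicHecke n ξ μ)ˣ) :
      CyclotomicHecke n ξ μ))
  map_L₁ : ξ = 1 → f (L ξ κ 0) = -L ξ μ 0
  map_affineL₁ : ξ ≠ 1 → f (affineL₁ ξ κ) =
    (((unitAffineL₁ ξ μ)⁻¹ : (CyclotomicHecke n ξ μ)ˣ) : CyclotomicHecke n ξ μ)

/-- The identification of the algebras of two equal multicharges. -/
noncomputable def congr {Z : Type*} [CommRing Z] {n : ℕ} [NeZero n] {l : ℕ} {ξ : Zˣ} {κ μ : Fin l → ℤ}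
    (h : κ = μ) : CyclotomicHecke n ξ κ ≃ₐ[Z] CyclotomicHecke n ξ μ :=
  h ▸ AlgEquiv.refl

end CyclotomicHecke

/-! Write s = ξ - 1 and u = s L_1 + 1.

Existence. The relations force ξ L_{r+1} = T_r L_r T_r + T_r, so the algebra is already presented by
L_1 and the T_r: the Hecke relations among the T_r, L_1 commuting with T_r for r > 1 and with Y =
T_1 L_1 T_1 + T_1, and the cyclotomic polynomial (`exists_lift`). The quadratic relation gives -ξ
T_r⁻¹ = s - T_r, and the single formula L_1 ↦ -L_1 u⁻¹ covers both cases: it is -L_1 when ξ = 1, and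
it always sends u to u⁻¹. The images satisfy the affine relations (`IsHeckeSystem.hash`) and the
cyclotomic one (`aeval_hash`). Applying the formulas twice gives the identity, hence the involution.

Uniqueness. For ξ ≠ 1 the condition on u determines only s times the image of L_1, so s must be
cancelled: the algebra over a domain has to be torsion free (`smul_eq_zero_imp`). This goes by
induction on n, starting from H_1 = Z[y]/(f) with f the monic cyclotomic polynomial. For the step,
H_{n+1} acts on M, a sum of n + 1 copies of Z[y]/(f) ⊗ H_n, the k-th copy modelling the elements T_k
⋯ T_1 b(L_1) T_1 ⋯ T_n a. The operators are written down by hand and checked against the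
presentation (`IndModule.isHeckeSystem`, `aeval_opL`). An equivariant map M → H_{n+1} sends the
vector 1 ⊗ 1 of copy 0 to the unit T_1 ⋯ T_n. If c kills a, then c kills a (1 ⊗ 1) in the module M,
where c acts injectively, so a T_1 ⋯ T_n = 0 and a = 0. Injectivity of M → H_{n+1}, and so a basis
theorem, is never needed. -/

/-- Elements `x` and `t 0, …, t (n - 2)` of a `Z`-algebra that satisfy the relations of `L_1` and
`T_1, …, T_{n-1}` in an affine Hecke algebra. -/
structure IsHeckeSystem {Z A : Type*} [CommRing Z] [Ring A] [Algebra Z A] (ξ : Zˣ) (n : ℕ)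
    (x : A) (t : ℕ → A) : Prop where
  quad : ∀ r, r + 1 < n → t r * t r = ((ξ : Z) - 1) • t r + (ξ : Z) • (1 : A)
  far : ∀ r s, r + 1 < s → s + 1 < n → t r * t s = t s * t r
  braid : ∀ r, r + 2 < n → t r * t (r + 1) * t r = t (r + 1) * t r * t (r + 1)
  x_t : ∀ r, 0 < r → r + 1 < n → x * t r = t r * x
  x_y : 1 < n → x * (t 0 * x * t 0 + t 0) = (t 0 * x * t 0 + t 0) * x

/-- An element commuting with `x` commutes with every polynomial in `x`. -/
theorem commute_aeval {Z A : Type*} [CommRing Z] [Ring A] [Algebra Z A] {a x : A}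
    (h : Commute a x) (p : Polynomial Z) : Commute a (p.aeval x) := by
  induction p using Polynomial.induction_on' with
  | add p q hp hq => rw [map_add]; exact hp.add_right hq
  | monomial n c =>
    rw [Polynomial.aeval_monomial]
    exact (Algebra.commute_algebraMap_right c a).mul_right (h.pow_right n)

/-! ### Jucys-Murphy elements built from `x` and the `t r`. -/

namespace IsHeckeSystem

variable {Z A : Type*} [CommRing Z] [Ring A] [Algebra Z A] {ξ : Zˣ} {n : ℕ} {x : A} {t : ℕ → A}

theorem mono (h : IsHeckeSystem ξ n x t) {m : ℕ} (hm : m ≤ n) : IsHeckeSystem ξ m x t where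
  quad r hr := h.quad r (by omega)
  far r s hr hs := h.far r s hr (by omega)
  braid r hr := h.braid r (by omega)
  x_t r h0 hr := h.x_t r h0 (by omega)
  x_y hn := h.x_y (by omega)

/-- The Jucys-Murphy elements of a Hecke system. -/
def jm (ξ : Zˣ) (x : A) (t : ℕ → A) : ℕ → A
  | 0 => x
  | r + 1 => ((ξ⁻¹ : Zˣ) : Z) • (t r * jm ξ x t r * t r + t r)

theorem smul_jm_succ (ξ : Zˣ) (x : A) (t : ℕ → A) (r : ℕ) :
    (ξ : Z) • jm ξ x t (r + 1) = t r * jm ξ x t r * t r + t r := by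
  rw [jm, smul_smul, Units.mul_inv, one_smul]

theorem smul_cancel (ξ : Zˣ) {a b : A} (h : (ξ : Z) • a = (ξ : Z) • b) : a = b := by
  have := congrArg (fun z => ((ξ⁻¹ : Zˣ) : Z) • z) h
  simpa only [smul_smul, Units.inv_mul, one_smul] using this

theorem commute_of_smul {ξ : Zˣ} {a b : A} (h : Commute a ((ξ : Z) • b)) : Commute a b := by
  apply smul_cancel ξ
  rw [← mul_smul_comm, ← smul_mul_assoc]
  exact h

/-- An element commuting with `x` and `t 0, …, t (s - 1)` commutes with the `s`-th Jucys-Murphy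
element. -/
theorem commute_jm {a : A} (s : ℕ) (hx : Commute a x) (ht : ∀ r < s, Commute a (t r)) :
    Commute a (jm ξ x t s) := by
  induction s with
  | zero => exact hx
  | succ s ih =>
    apply commute_of_smul (ξ := ξ)
    rw [smul_jm_succ]
    have h1 := ih fun r hr => ht r (by omega)
    have h2 := ht s (by omega)
    exact ((h2.mul_right h1).mul_right h2).add_right h2

theorem t_jm_of_lt (h : IsHeckeSystem ξ n x t) {r s : ℕ} (hs : s < r) (hr : r + 1 < n) :
    Commute (t r) (jm ξ x t s) :=
  commute_jm s (h.x_t r (by omega) hr).symm fun i hi => (h.far i r (by omega) hr).symm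

/-- With a = `t r`, b = `t (r + 1)`, the braid relation makes a commute with b a z a b. The terms b
a b and ξ b fail to commute with a separately; their defects ξ(ba - ab) and ξ(ab - ba) cancel. -/
theorem t_jm_add_two (h : IsHeckeSystem ξ n x t) {r : ℕ} (hr : r + 2 < n) :
    Commute (t r) (jm ξ x t (r + 2)) := by
  apply commute_of_smul (ξ := ξ)
  rw [smul_jm_succ]
  set a := t r
  set b := t (r + 1)
  set z := jm ξ x t r
  have hb : b * z = z * b := h.t_jm_of_lt (by omega) (by omega)
  have hbr : a * b * a = b * a * b := h.braid r hr
  have hqb : b * b = ((ξ : Z) - 1) • b + (ξ : Z) • (1 : A) := h.quad (r + 1) (by omega)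
  apply commute_of_smul (ξ := ξ)
  have e : (ξ : Z) • (b * jm ξ x t (r + 1) * b + b) =
      b * a * z * a * b + b * a * b + (ξ : Z) • b := by
    rw [smul_add, ← smul_mul_assoc, ← mul_smul_comm, smul_jm_succ]
    noncomm_ring
  rw [e]
  have h1 : a * (b * a * z * a * b) = b * a * z * a * b * a := by
    calc a * (b * a * z * a * b) = (a * b * a) * z * a * b := by noncomm_ring
      _ = b * a * (b * z) * a * b := by rw [hbr]; noncomm_ring
      _ = b * a * z * (b * a * b) := by rw [hb]; noncomm_ring
      _ = _ := by rw [← hbr]; noncomm_ring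
  have h2 : a * (b * a * b) = ((ξ : Z) - 1) • (b * a * b) + (ξ : Z) • (b * a) := by
    calc a * (b * a * b) = (a * b * a) * b := by noncomm_ring
      _ = b * a * (b * b) := by rw [hbr]; noncomm_ring
      _ = _ := by rw [hqb, mul_add, mul_smul_comm, mul_smul_comm, mul_one]
  have h3 : (b * a * b) * a = ((ξ : Z) - 1) • (b * a * b) + (ξ : Z) • (a * b) := by
    calc (b * a * b) * a = b * (a * b * a) := by noncomm_ring
      _ = (b * b) * (a * b) := by rw [hbr]; noncomm_ring
      _ = _ := by
        rw [hqb, add_mul, smul_mul_assoc, smul_mul_assoc, one_mul]; noncomm_ring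
  change a * _ = _ * a
  rw [mul_add, mul_add, add_mul, add_mul, h1, h2, h3, mul_smul_comm, smul_mul_assoc]
  abel

theorem t_jm_of_gt (h : IsHeckeSystem ξ n x t) {r s : ℕ} (hs : r + 2 ≤ s) (hn : s < n) :
    Commute (t r) (jm ξ x t s) := by
  induction s, hs using Nat.le_induction with
  | base => exact h.t_jm_add_two hn
  | succ s hs ih =>
    apply commute_of_smul (ξ := ξ)
    rw [smul_jm_succ]
    have h1 := ih (by omega)
    have h2 : Commute (t r) (t s) := h.far r s (by omega) (by omega)
    exact ((h2.mul_right h1).mul_right h2).add_right h2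

theorem x_jm (h : IsHeckeSystem ξ n x t) {s : ℕ} (hn : s < n) : Commute x (jm ξ x t s) := by
  induction s with
  | zero => exact Commute.refl x
  | succ s ih =>
    apply commute_of_smul (ξ := ξ)
    rw [smul_jm_succ]
    rcases Nat.eq_zero_or_pos s with rfl | hs
    · exact h.x_y (by omega)
    · have h1 := ih (by omega)
      have h2 : Commute x (t s) := h.x_t s hs (by omega)
      exact ((h2.mul_right h1).mul_right h2).add_right h2

/-- The element of smaller index r is built from `x` and the `t i` with i < r, all of which commute
with the element of larger index. -/
theorem jm_comm (h : IsHeckeSystem ξ n x t) {r s : ℕ} (hr : r < n) (hs : s < n) :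
    Commute (jm ξ x t r) (jm ξ x t s) := by
  rcases lt_trichotomy r s with hrs | rfl | hrs
  · exact (commute_jm r (h.x_jm hs).symm fun i hi => (h.t_jm_of_gt (by omega) hs).symm).symm
  · exact Commute.refl _
  · exact commute_jm s (h.x_jm hr).symm fun i hi => (h.t_jm_of_gt (by omega) hr).symm

theorem jm_succ_mul (h : IsHeckeSystem ξ n x t) {r : ℕ} (hr : r + 1 < n) :
    jm ξ x t (r + 1) * (t r - algebraMap Z A ξ + 1) = t r * jm ξ x t r + 1 := by
  apply smul_cancel ξ
  have hq := h.quad r hr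
  have h1 : t r * (t r - algebraMap Z A ξ + 1) = (ξ : Z) • (1 : A) := by
    rw [mul_add, mul_sub, hq, ← Algebra.commutes, ← Algebra.smul_def, mul_one]
    module
  rw [← smul_mul_assoc, smul_jm_succ, add_mul, mul_assoc (t r * _), h1, mul_smul_comm, mul_one,
    smul_add]

/-- The commutation rule of `x` with `t₀ p(x) t₀`. -/
theorem x_mul_t_p_t (h : IsHeckeSystem ξ n x t) (hn : 1 < n) (p : Polynomial Z) :
    x * (t 0 * p.aeval x * t 0) = t 0 * p.aeval x * t 0 * x
      + (((ξ : Z) - 1) • x + 1) * t 0 * p.aeval x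
      - p.aeval x * t 0 * (((ξ : Z) - 1) • x + 1) := by
  have hq := h.quad 0 hn
  have hxY := h.x_y hn
  set τ := t 0
  set Y := τ * x * τ + τ with hY
  have htY : τ * Y = ((ξ : Z) - 1) • Y + (ξ : Z) • (x * τ) + (ξ : Z) • (1 : A) := by
    have : τ * Y = (τ * τ) * x * τ + τ * τ := by rw [hY]; noncomm_ring
    rw [this, hq, hY]
    simp only [add_mul, smul_mul_assoc, one_mul]
    module
  clear_value Y
  induction p using Polynomial.induction_on with
  | C a =>
    simp only [Polynomial.aeval_C, Algebra.algebraMap_eq_smul_one, mul_smul_comm, smul_mul_assoc,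
      mul_one, one_mul, hq, mul_add, add_mul]
    module
  | add p q hp hq =>
    rw [map_add]
    simp only [mul_add, add_mul, smul_mul_assoc, one_mul, mul_smul_comm, mul_one,
      mul_assoc] at hp hq ⊢
    linear_combination (norm := module) hp + hq
  | monomial n a ih =>
    have e : Polynomial.C a * Polynomial.X ^ (n + 1)
        = Polynomial.C a * Polynomial.X ^ n * Polynomial.X := by ring
    rw [e, map_mul _ _ Polynomial.X, Polynomial.aeval_X]
    set p := Polynomial.C a * Polynomial.X ^ n
    have hPx : Polynomial.aeval x p * x = x * Polynomial.aeval x p := by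
      have := congrArg (Polynomial.aeval x) (mul_comm p Polynomial.X)
      simpa only [map_mul, Polynomial.aeval_X] using this
    have hPY : Polynomial.aeval x p * Y = Y * Polynomial.aeval x p :=
      (commute_aeval (show Commute Y x from hxY.symm) p).symm
    set P := Polynomial.aeval x p
    clear_value P
    -- `htY` expresses ξ x τ as τ Y - (ξ - 1) Y - ξ, and Y commutes with x and with P. Thus ξ times
    -- the claim for p X is the claim for p multiplied by Y on the right, up to terms that these
    -- identities cancel.
    have a1 := congrArg (fun z => x * (τ * (P * z))) htY
    have a2 := congrArg (fun z => τ * (P * (z * x))) htY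
    have a3 := congrArg (fun z => z * Y) ih
    have c1 := congrArg (fun z => τ * (P * (τ * z))) hxY
    have c3 := congrArg (fun z => τ * z) hPY
    have c3' := congrArg (fun z => z * P) htY
    have c4 := congrArg (fun z => τ * (z * x)) hPY
    have c4' := congrArg (fun z => z * P * x) htY
    have c5 := congrArg (fun z => P * (τ * z)) hxY
    have c5' := congrArg (fun z => P * (z * x)) htY
    have c6 := congrArg (fun z => P * z) htY
    have c8 := congrArg (fun z => z * x) hPY
    apply smul_cancel ξ
    simp only [mul_add, add_mul, sub_mul, smul_mul_assoc, one_mul, mul_smul_comm, mul_one,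
      mul_assoc] at a1 a2 a3 c1 c3 c3' c4 c4' c5 c5' c6 c8 hPY ⊢
    linear_combination (norm := module) a2 - a1 + a3 + c1 + c3 + c3'
      + ((ξ : Z) - 1) • (c4 + c4') - ((ξ : Z) - 1) • (c5 + c5') - c6 - ((ξ : Z) - 1) • hPY
      - (((ξ : Z) - 1) * ((ξ : Z) - 1)) • c8

end IsHeckeSystem

/-! ### Presentation of the cyclotomic Hecke algebra by L_1 and the T_r. -/

namespace CyclotomicHecke

variable {Z : Type*} [CommRing Z]

/-- The polynomial `∏ (X - [κ_i]_ξ)` of the cyclotomic relation. -/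
noncomputable def cycPoly {l : ℕ} (ξ : Zˣ) (κ : Fin l → ℤ) : Polynomial Z :=
  (List.ofFn fun i : Fin l => (Polynomial.X - Polynomial.C (quantumInt ξ (κ i)))).prod

theorem cycPoly_monic {l : ℕ} (ξ : Zˣ) (κ : Fin l → ℤ) : (cycPoly ξ κ).Monic := by
  rw [cycPoly, List.prod_ofFn]
  exact Polynomial.monic_prod_of_monic _ _ fun i _ => Polynomial.monic_X_sub_C _

theorem aeval_cycPoly {A : Type*} [Ring A] [Algebra Z A] {l : ℕ} (ξ : Zˣ) (κ : Fin l → ℤ) (x : A) :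
    (cycPoly ξ κ).aeval x =
      (List.ofFn fun i : Fin l => x - algebraMap Z A (quantumInt ξ (κ i))).prod := by
  rw [cycPoly, map_list_prod, List.map_ofFn]
  congr 2
  funext i
  simp

variable {n : ℕ} [NeZero n] {l : ℕ} (ξ : Zˣ) (κ : Fin l → ℤ)

/-- The generators `T_{r+1}`, extended by zero to all natural numbers `r`. -/
noncomputable def tSeq (n : ℕ) [NeZero n] {l : ℕ} (ξ : Zˣ) (κ : Fin l → ℤ) (r : ℕ) :
    CyclotomicHecke n ξ κ :=
  if h : r < n - 1 then T ξ κ ⟨r, h⟩ else 0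

theorem tSeq_val (r : Fin (n - 1)) : tSeq n ξ κ r = T ξ κ r := by
  rw [tSeq, dif_pos r.isLt]

theorem aeval_L_zero : (cycPoly ξ κ).aeval (L ξ κ (0 : Fin n)) = 0 := by
  rw [aeval_cycPoly, L_cyclotomic]

theorem T_mul_self (r : Fin (n - 1)) :
    T ξ κ r * T ξ κ r = ((ξ : Z) - 1) • T ξ κ r + (ξ : Z) • 1 := by
  have h := T_quadratic ξ κ r
  rw [Algebra.algebraMap_eq_smul_one] at h
  simp only [mul_sub, add_mul, one_mul, mul_smul_comm, mul_one] at h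
  linear_combination (norm := module) h

theorem L_comm (r s : Fin n) : L ξ κ r * L ξ κ s = L ξ κ s * L ξ κ r := by
  have h := mk_rel ξ κ (Rel.L_comm (ξ := ξ) (κ := κ) r s)
  simpa only [map_mul, L, T] using h

theorem T_comm (r s : Fin (n - 1)) (h : 1 < |(r.val : ℤ) - (s.val : ℤ)|) :
    T ξ κ r * T ξ κ s = T ξ κ s * T ξ κ r := by
  have h := mk_rel ξ κ (Rel.T_comm (ξ := ξ) (κ := κ) r s h)
  simpa only [map_mul, L, T] using h

theorem T_braid (r s : Fin (n - 1)) (h : s.val = r.val + 1) :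
    T ξ κ r * T ξ κ s * T ξ κ r = T ξ κ s * T ξ κ r * T ξ κ s := by
  have h := mk_rel ξ κ (Rel.braid (ξ := ξ) (κ := κ) r s h)
  simpa only [map_mul, L, T] using h

theorem T_L_comm (r : Fin (n - 1)) (s : Fin n) (h : s ≠ idx r) (h' : s ≠ idxSucc r) :
    T ξ κ r * L ξ κ s = L ξ κ s * T ξ κ r := by
  have h := mk_rel ξ κ (Rel.T_L_comm (ξ := ξ) (κ := κ) r s h h')
  simpa only [map_mul, L, T] using h

/-- Multiply the last defining relation by T_r on the right: (T_r - ξ + 1) T_r = ξ by the quadratic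
relation. -/
theorem smul_L_succ (r : Fin (n - 1)) :
    (ξ : Z) • L ξ κ (idxSucc r) = T ξ κ r * L ξ κ (idx r) * T ξ κ r + T ξ κ r := by
  have h := mk_rel ξ κ (Rel.L_succ (ξ := ξ) (κ := κ) r)
  simp only [map_mul, map_add, map_sub, map_one, AlgHom.commutes] at h
  change L ξ κ (idxSucc r) * (T ξ κ r - _ + 1) = T ξ κ r * L ξ κ (idx r) + 1 at h
  have h1 : (T ξ κ r - algebraMap Z _ (ξ : Z) + 1) * T ξ κ r = (ξ : Z) • 1 := by
    rw [add_mul, sub_mul, T_mul_self, ← Algebra.smul_def, one_mul]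
    module
  have h2 := congrArg (fun z => z * T ξ κ r) h
  simpa only [mul_assoc, h1, mul_smul_comm, mul_one, add_mul, one_mul] using h2

theorem isHeckeSystem (n : ℕ) [NeZero n] {l : ℕ} (ξ : Zˣ) (κ : Fin l → ℤ) :
    IsHeckeSystem ξ n (L ξ κ (0 : Fin n)) (tSeq n ξ κ) where
  quad r hr := by
    rw [tSeq, dif_pos (by omega), T_mul_self]
  far r s hr hs := by
    rw [tSeq, tSeq, dif_pos (by omega), dif_pos (by omega)]
    apply T_comm
    rw [abs_sub_comm]
    exact lt_of_lt_of_le (by push_cast; omega) (le_abs_self _)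
  braid r hr := by
    rw [tSeq, tSeq, dif_pos (by omega), dif_pos (by omega)]
    exact T_braid ξ κ _ _ rfl
  x_t r h0 hr := by
    rw [tSeq, dif_pos (by omega)]
    refine (T_L_comm ξ κ _ _ ?_ ?_).symm
    · intro h
      have := congrArg Fin.val h
      simp [idx] at this
      omega
    · intro h
      have := congrArg Fin.val h
      simp [idxSucc] at this
  x_y hn := by
    have h := smul_L_succ ξ κ (⟨0, by omega⟩ : Fin (n - 1))
    have e : idx (⟨0, by omega⟩ : Fin (n - 1)) = 0 := Fin.ext (by simp [idx])
    rw [e] at h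
    rw [tSeq, dif_pos (by omega), ← h, mul_smul_comm, smul_mul_assoc, L_comm]

/-- The universal property of the cyclotomic Hecke algebra in terms of `L_1` and the `T_r`. -/
theorem exists_lift {A : Type*} [Ring A] [Algebra Z A] {x : A} {t : ℕ → A}
    (h : IsHeckeSystem ξ n x t) (hx : (cycPoly ξ κ).aeval x = 0) :
    ∃ φ : CyclotomicHecke n ξ κ →ₐ[Z] A,
      φ (L ξ κ (0 : Fin n)) = x ∧ ∀ r : Fin (n - 1), φ (T ξ κ r) = t r := by
  -- The images of the L_k are forced by the recursion, so they must be the elements `jm`.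
  let g : Gen n → A
    | .L k => IsHeckeSystem.jm ξ x t k
    | .T r => t r
  have hL : ∀ k, FreeAlgebra.lift Z g (freeL Z k) = IsHeckeSystem.jm ξ x t k := fun k =>
    FreeAlgebra.lift_ι_apply g _
  have hT : ∀ r, FreeAlgebra.lift Z g (freeT Z r) = t r := fun r =>
    FreeAlgebra.lift_ι_apply g _
  have hrel : ∀ ⦃a b⦄, Rel n ξ κ a b → FreeAlgebra.lift Z g a = FreeAlgebra.lift Z g b := by
    intro a b hab
    induction hab with
    | cyclotomic =>
      rw [map_list_prod, List.map_ofFn, map_zero, ← hx, aeval_cycPoly]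
      congr 2
      funext i
      simp only [Function.comp, map_sub, AlgHom.commutes, hL]
      rfl
    | quadratic r =>
      have := h.quad r (by omega)
      simp only [map_mul, map_add, map_sub, map_one, map_zero, AlgHom.commutes, hT]
      rw [Algebra.algebraMap_eq_smul_one]
      simp only [add_mul, mul_sub, this, mul_smul_comm, mul_one, one_mul]
      module
    | L_comm r s => simpa only [map_mul, hL] using (h.jm_comm r.isLt s.isLt).eq
    | T_comm r s hrs =>
      simp only [map_mul, hT]
      rcases lt_trichotomy (r : ℕ) (s : ℕ) with h1 | h1 | h1
      · refine h.far r s ?_ (by omega)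
        rw [abs_of_neg (by omega)] at hrs
        omega
      · rw [h1]
      · refine (h.far s r ?_ (by omega)).symm
        rw [abs_of_pos (by omega)] at hrs
        omega
    | braid r s hrs =>
      simp only [map_mul, hT, hrs]
      exact h.braid r (by omega)
    | T_L_comm r s h1 h2 =>
      simp only [map_mul, hT, hL]
      have h1' : (s : ℕ) ≠ r := fun e => h1 (Fin.ext e)
      have h2' : (s : ℕ) ≠ r + 1 := fun e => h2 (Fin.ext e)
      rcases lt_or_ge (s : ℕ) r with h3 | h3
      · exact h.t_jm_of_lt h3 (by omega)
      · exact h.t_jm_of_gt (by omega) s.isLt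
    | L_succ r =>
      simp only [map_mul, map_add, map_sub, map_one, AlgHom.commutes, hT, hL]
      exact h.jm_succ_mul (by omega)
  have hmk : ∀ a, RingQuot.liftAlgHom Z ⟨FreeAlgebra.lift Z g, hrel⟩ (mk ξ κ a)
      = FreeAlgebra.lift Z g a := fun a => RingQuot.liftAlgHom_mkAlgHom_apply _ _ hrel a
  exact ⟨RingQuot.liftAlgHom Z ⟨FreeAlgebra.lift Z g, hrel⟩, (hmk _).trans (hL 0),
    fun r => (hmk _).trans (hT r)⟩

/-- `L_1` and the `T_r` generate the cyclotomic Hecke algebra. -/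
theorem subalgebra_eq_top {S : Subalgebra Z (CyclotomicHecke n ξ κ)} (hL : L ξ κ 0 ∈ S)
    (hT : ∀ r, T ξ κ r ∈ S) : S = ⊤ := by
  have hL' : ∀ k (hk : k < n), L ξ κ ⟨k, hk⟩ ∈ S := by
    intro k
    induction k with
    | zero => exact fun _ => hL
    | succ k ih =>
      intro hk
      have h := smul_L_succ ξ κ (⟨k, by omega⟩ : Fin (n - 1))
      have h1 : (ξ : Z) • L ξ κ ⟨k + 1, hk⟩ ∈ S :=
        h ▸ S.add_mem (S.mul_mem (S.mul_mem (hT _) (ih _)) (hT _)) (hT _)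
      have h2 := S.smul_mem h1 ((ξ⁻¹ : Zˣ) : Z)
      rwa [smul_smul, Units.inv_mul, one_smul] at h2
  refine eq_top_iff.mpr fun a _ => ?_
  obtain ⟨a, rfl⟩ : ∃ b, mk ξ κ b = a := RingQuot.mkAlgHom_surjective Z _ a
  induction a with
  | grade0 c => rw [AlgHom.commutes]; exact S.algebraMap_mem c
  | grade1 g =>
    cases g with
    | L k => exact hL' k k.isLt
    | T r => exact hT r
  | mul a b ha hb => rw [map_mul]; exact S.mul_mem (ha trivial) (hb trivial)
  | add a b ha hb => rw [map_add]; exact S.add_mem (ha trivial) (hb trivial)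

theorem algHom_ext {A : Type*} [Ring A] [Algebra Z A] {f g : CyclotomicHecke n ξ κ →ₐ[Z] A}
    (hL : f (L ξ κ 0) = g (L ξ κ 0)) (hT : ∀ r, f (T ξ κ r) = g (T ξ κ r)) : f = g := by
  have h : AlgHom.equalizer f g = ⊤ := subalgebra_eq_top ξ κ hL hT
  exact AlgHom.ext fun a => (h ▸ Algebra.mem_top : a ∈ AlgHom.equalizer f g)

end CyclotomicHecke

/-! ### The induced module: operators and relations among the T_r. -/

/-- A Hecke system in an algebra `N` over `B`, with an element `y` of `B` and a map `φ` that
behaves like the substitution of `X` for `y`, the values being placed on the left. -/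
structure IsEvalSystem {Z B N : Type*} [CommRing Z] [CommRing B] [Algebra Z B] [Ring N]
    [Algebra Z N] [Algebra B N] [IsScalarTower Z B N] (ξ : Zˣ) (n : ℕ) (f : Polynomial Z)
    (y : B) (X : N) (τ : ℕ → N) (φ : N →ₗ[Z] N) : Prop where
  sys : IsHeckeSystem ξ n X τ
  aeval_y : f.aeval y = 0
  aeval_X : f.aeval X = 0
  φ_y : ∀ m, φ (y • m) = X * φ m
  φ_X : ∀ m, φ (X * m) = X * φ m
  φ_τ : ∀ r, 0 < r → r + 1 < n → ∀ m, φ (τ r * m) = τ r * φ m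
  φ_φ : ∀ m, φ (φ m) = φ m
  φ_τ_φ : ∀ m, φ (τ 0 * φ m) = τ 0 * φ m
  φ_Y : 1 < n → ∀ m, φ ((τ 0 * X * τ 0 + τ 0) * m) = (τ 0 * X * τ 0 + τ 0) * φ m
  comm : 1 < n → ∀ m, X * (τ 0 * φ (τ 0 * m)) = τ 0 * φ (τ 0 * (X * m))
    + (((ξ : Z) - 1) • X + 1) * (τ 0 * φ m) - φ (τ 0 * ((((ξ : Z) - 1) • X + 1) * m))
  span : ∀ K : Submodule Z N, (∀ m, φ m ∈ K) → (∀ m ∈ K, y • m ∈ K) → K = ⊤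

namespace IndModule

variable {Z B N : Type*} [CommRing Z] [CommRing B] [Algebra Z B] [Ring N]
    [Algebra Z N] [Algebra B N] [IsScalarTower Z B N] (ξ : Zˣ) (n : ℕ)
    (y : B) (X : N) (τ : ℕ → N) (φ : N →ₗ[Z] N)

/-- The inclusion of the `k`-th summand, zero for `k > n`. -/
def e (Z : Type*) [CommRing Z] {N : Type*} [Ring N] [Algebra Z N] (n k : ℕ) :
    N →ₗ[Z] (Fin (n + 1) → N) :=
  if h : k < n + 1 then LinearMap.single Z (fun _ => N) ⟨k, h⟩ else 0

/-- The linear map with prescribed restrictions to the summands. -/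
def sumMap {Q : Type*} [AddCommGroup Q] [Module Z Q] (g : ℕ → N →ₗ[Z] Q) :
    (Fin (n + 1) → N) →ₗ[Z] Q :=
  LinearMap.lsum Z (fun _ : Fin (n + 1) => N) Z fun i => g i

theorem sumMap_e {Q : Type*} [AddCommGroup Q] [Module Z Q] (g : ℕ → N →ₗ[Z] Q) {k : ℕ}
    (hk : k ≤ n) (m : N) : sumMap n g (e Z n k m) = g k m := by
  rw [e, dif_pos (by omega), sumMap]
  exact LinearMap.lsum_piSingle Z (fun _ : Fin (n + 1) => N) Z (fun i => g i) ⟨k, by omega⟩ m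

theorem ext_e {Q : Type*} [AddCommGroup Q] [Module Z Q] {g h : (Fin (n + 1) → N) →ₗ[Z] Q}
    (H : ∀ k ≤ n, ∀ m, g (e Z n k m) = h (e Z n k m)) : g = h := by
  refine LinearMap.pi_ext fun i m => ?_
  have := H i (by omega) m
  rwa [e, dif_pos i.isLt] at this

/-- The action of `T_{r+1}`. -/
def opT (r : ℕ) : Module.End Z (Fin (n + 1) → N) :=
  sumMap n fun k =>
    if k = r then e Z n (r + 1)
    else if k = r + 1 then ((ξ : Z) - 1) • e Z n (r + 1) + (ξ : Z) • e Z n r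
    else if k < r then e Z n k ∘ₗ LinearMap.mulLeft Z (τ (r - 1))
    else e Z n k ∘ₗ LinearMap.mulLeft Z (τ r)

theorem opT_self {r : ℕ} (hr : r ≤ n) (m : N) :
    opT ξ n τ r (e Z n r m) = e Z n (r + 1) m := by
  rw [opT, sumMap_e n _ hr, if_pos rfl]

theorem opT_succ {r : ℕ} (hr : r + 1 ≤ n) (m : N) : opT ξ n τ r (e Z n (r + 1) m) =
    ((ξ : Z) - 1) • e Z n (r + 1) m + (ξ : Z) • e Z n r m := by
  rw [opT, sumMap_e n _ hr, if_neg (by omega), if_pos rfl]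
  rfl

/-- In the model, `t r` passes `desc` unchanged and then drops to `t (r - 1)` across the ascending
product. When k > r + 1 it first rises to `t (r + 1)` in `desc`, then drops back to `t r`. -/
theorem opT_lt {k r : ℕ} (hr : k < r) (hn : k ≤ n) (m : N) :
    opT ξ n τ r (e Z n k m) = e Z n k (τ (r - 1) * m) := by
  rw [opT, sumMap_e n _ hn, if_neg (by omega), if_neg (by omega), if_pos hr]
  rfl

theorem opT_gt {k r : ℕ} (hr : r + 1 < k) (hn : k ≤ n) (m : N) :
    opT ξ n τ r (e Z n k m) = e Z n k (τ r * m) := by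
  rw [opT, sumMap_e n _ hn, if_neg (by omega), if_neg (by omega), if_neg (by omega)]
  rfl

/-- The descending product `τ (k - 1) ⋯ τ 0`. -/
def desc {N : Type*} [Ring N] (τ : ℕ → N) : ℕ → N
  | 0 => 1
  | k + 1 => τ k * desc τ k

/-- The action of `L_1`. -/
def opL : Module.End Z (Fin (n + 1) → N) :=
  sumMap n fun k =>
    match k with
    | 0 => e Z n 0 ∘ₗ (LinearMap.lsmul B N y).restrictScalars Z
    | k + 1 => e Z n (k + 1) ∘ₗ LinearMap.mulLeft Z X + e Z n 0 ∘ₗ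
      ((LinearMap.lsmul B N (((ξ : Z) - 1) • y + 1)).restrictScalars Z ∘ₗ
          LinearMap.mulLeft Z (desc τ k) ∘ₗ φ
        - LinearMap.mulLeft Z (desc τ k * (((ξ : Z) - 1) • X + 1)))

theorem opL_zero (m : N) : opL ξ n y X τ φ (e Z n 0 m) = e Z n 0 (y • m) := by
  rw [opL, sumMap_e n _ (Nat.zero_le n)]
  rfl

/-- The second summand is the correction for moving L_1 past the two factors T_1 that enclose b(L_1)
in the model; it is dictated by `x_mul_t_p_t`. -/
theorem opL_succ {k : ℕ} (hk : k + 1 ≤ n) (m : N) : opL ξ n y X τ φ (e Z n (k + 1) m) =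
    e Z n (k + 1) (X * m) + e Z n 0 ((((ξ : Z) - 1) • y + 1) • (desc τ k * φ m)
      - desc τ k * ((((ξ : Z) - 1) • X + 1) * m)) := by
  rw [opL, sumMap_e n _ hk, ← mul_assoc]
  rfl

variable {ξ n y X τ φ}

theorem mul_desc_of_lt (h : IsHeckeSystem ξ n X τ) {r k : ℕ} (hr : k < r) (hn : r + 1 < n) :
    τ r * desc τ k = desc τ k * τ r := by
  induction k with
  | zero => simp [desc]
  | succ k ih =>
    rw [desc, ← mul_assoc, ← h.far k r (by omega) hn, mul_assoc, ih (by omega), mul_assoc]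

theorem mul_desc_of_gt (h : IsHeckeSystem ξ n X τ) {r k : ℕ} (hr : r + 1 < k) (hn : k < n) :
    τ r * desc τ k = desc τ k * τ (r + 1) := by
  induction k with
  | zero => omega
  | succ k ih =>
    rcases eq_or_ne k (r + 1) with rfl | hk
    · rw [desc, desc, ← mul_assoc, ← mul_assoc, h.braid r (by omega), mul_assoc,
        mul_desc_of_lt h (by omega) (by omega)]
      simp only [mul_assoc]
    · rw [desc, ← mul_assoc, h.far r k (by omega) (by omega), mul_assoc, ih (by omega) (by omega),
        mul_assoc]

/-- On copies whose index the operators do not move, the relations reduce to those of the `τ`, with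
shifted indices. The copies that are moved need only the definition, except copy r + 2 in the braid
relation, which also uses the quadratic relation of `τ r`. -/
theorem isHeckeSystem_opT (h : IsHeckeSystem ξ n X τ) :
    (∀ r, r + 1 < n + 1 → opT (Z := Z) ξ n τ r * opT ξ n τ r
      = ((ξ : Z) - 1) • opT ξ n τ r + (ξ : Z) • 1) ∧
    (∀ r s, r + 1 < s → s + 1 < n + 1 →
      opT (Z := Z) ξ n τ r * opT ξ n τ s = opT ξ n τ s * opT ξ n τ r) ∧
    (∀ r, r + 2 < n + 1 → opT (Z := Z) ξ n τ r * opT ξ n τ (r + 1) * opT ξ n τ r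
      = opT ξ n τ (r + 1) * opT ξ n τ r * opT ξ n τ (r + 1)) := by
  refine ⟨fun r hr => ?_, fun r s hr hs => ?_, fun r hr => ?_⟩
  · refine ext_e n fun k hk m => ?_
    simp only [Module.End.mul_apply, LinearMap.add_apply, LinearMap.smul_apply,
      Module.End.one_apply]
    obtain hc | rfl | rfl | hc : k < r ∨ k = r ∨ k = r + 1 ∨ r + 1 < k := by omega
    · simp only [opT_lt ξ n τ hc hk]
      rw [← mul_assoc, h.quad (r - 1) (by omega), add_mul, map_add, smul_mul_assoc,
        smul_mul_assoc, one_mul, map_smul, map_smul]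
    · simp (disch := omega) only [opT_self, opT_succ]
    · simp (disch := omega) only [opT_self, opT_succ, map_add, map_smul]
    · simp only [opT_gt ξ n τ hc hk]
      rw [← mul_assoc, h.quad r (by omega), add_mul, map_add, smul_mul_assoc,
        smul_mul_assoc, one_mul, map_smul, map_smul]
  · refine ext_e n fun k hk m => ?_
    simp only [Module.End.mul_apply]
    obtain hc | rfl | rfl | hc | rfl | rfl | hc : k < r ∨ k = r ∨ k = r + 1 ∨ (r + 1 < k ∧ k < s)
      ∨ k = s ∨ k = s + 1 ∨ s + 1 < k := by omega
    · simp (disch := omega) only [opT_lt]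
      rw [← mul_assoc, h.far (r - 1) (s - 1) (by omega) (by omega), mul_assoc]
    · simp (disch := omega) only [opT_lt, opT_self]
    · simp (disch := omega) only [opT_lt, opT_succ, map_add, map_smul]
    · simp (disch := omega) only [opT_lt, opT_gt]
      rw [← mul_assoc, h.far r (s - 1) (by omega) (by omega), mul_assoc]
    · simp (disch := omega) only [opT_gt, opT_self]
    · simp (disch := omega) only [opT_gt, opT_succ, map_add, map_smul]
    · simp (disch := omega) only [opT_gt]
      rw [← mul_assoc, h.far r s (by omega) (by omega), mul_assoc]
  · refine ext_e n fun k hk m => ?_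
    simp only [Module.End.mul_apply]
    obtain hc | rfl | rfl | rfl | hc : k < r ∨ k = r ∨ k = r + 1 ∨ k = r + 1 + 1 ∨ r + 2 < k := by
      omega
    · simp (disch := omega) only [opT_lt]
      have := h.braid (r - 1) (by omega)
      rw [Nat.sub_add_cancel (by omega : 1 ≤ r)] at this
      rw [Nat.add_sub_cancel, ← mul_assoc, ← mul_assoc, this]
      simp only [mul_assoc]
    · simp (disch := omega) only [opT_lt, opT_self, opT_gt, Nat.add_sub_cancel]
    · simp (disch := omega) only [opT_lt, opT_self, opT_gt, opT_succ, map_add, map_smul,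
        Nat.add_sub_cancel]
    · simp (disch := omega) only [opT_lt, opT_self, opT_gt, opT_succ, map_add, map_smul,
        Nat.add_sub_cancel]
      rw [← mul_assoc, h.quad r (by omega), add_mul, map_add, smul_mul_assoc,
        smul_mul_assoc, one_mul, map_smul, map_smul]
      module
    · simp (disch := omega) only [opT_gt]
      rw [← mul_assoc, ← mul_assoc, h.braid r (by omega)]
      simp only [mul_assoc]

end IndModule

/-! ### The induced module: relations involving L_1. -/

namespace IndModule

variable {Z B N : Type*} [CommRing Z] [CommRing B] [Algebra Z B] [Ring N]
    [Algebra Z N] [Algebra B N] [IsScalarTower Z B N] {ξ : Zˣ} {n : ℕ} {f : Polynomial Z}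
    {y : B} {X : N} {τ : ℕ → N} {φ : N →ₗ[Z] N}

theorem smul_scalar_comm (b : B) (c : Z) (m : N) : b • c • m = c • b • m := by
  rw [← algebraMap_smul B c m, ← algebraMap_smul B c (b • m), smul_smul, smul_smul, mul_comm]

theorem opL_opT (h : IsEvalSystem ξ n f y X τ φ) {r : ℕ} (hr : r + 1 < n) :
    opL ξ n y X τ φ * opT ξ n τ (r + 1) = opT ξ n τ (r + 1) * opL ξ n y X τ φ := by
  have hX : ∀ s, 0 < s → s + 1 < n → ∀ m, X * (τ s * m) = τ s * (X * m) := fun s h0 hs m => by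
    rw [← mul_assoc, h.sys.x_t s h0 hs, mul_assoc]
  refine ext_e n fun k hk m => ?_
  simp only [Module.End.mul_apply]
  rcases k with _ | k
  · simp (disch := omega) only [opT_lt, opL_zero, mul_smul_comm]
  obtain hc | hc | hc | hc : k < r ∨ k = r ∨ k = r + 1 ∨ r + 1 < k := by omega
  · have hd : ∀ m, τ r * (desc τ k * m) = desc τ k * (τ r * m) := fun m => by
      rw [← mul_assoc, mul_desc_of_lt h.sys hc (by omega), mul_assoc]
    simp (disch := omega) only [opT_lt, opL_succ, map_add, Nat.add_sub_cancel, hX, h.φ_τ, add_mul,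
      smul_mul_assoc, one_mul, mul_sub, mul_add, mul_smul_comm, hd]
  · subst hc
    simp (disch := omega) only [opT_lt, opT_self, opL_succ, map_add, Nat.add_sub_cancel, desc,
      mul_sub, mul_smul_comm, mul_assoc]
  · subst hc
    have hd : ∀ m, τ r * (τ r * m) = ((ξ : Z) - 1) • (τ r * m) + (ξ : Z) • m := fun m => by
      rw [← mul_assoc, h.sys.quad r (by omega), add_mul, smul_mul_assoc, smul_mul_assoc, one_mul]
    simp (disch := omega) only [opT_lt, opT_succ, opL_succ, map_add, map_sub, map_smul,
      Nat.add_sub_cancel, desc, mul_smul_comm, mul_assoc, hd, add_smul, smul_assoc,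
      one_smul, smul_add, smul_scalar_comm (N := N) y]
    module
  · have hd : ∀ m, τ r * (desc τ k * m) = desc τ k * (τ (r + 1) * m) := fun m => by
      rw [← mul_assoc, mul_desc_of_gt h.sys hc (by omega), mul_assoc]
    simp (disch := omega) only [opT_lt, opT_gt, opL_succ, map_add, Nat.add_sub_cancel, hX, h.φ_τ,
      add_mul, smul_mul_assoc, one_mul, mul_sub, mul_add, mul_smul_comm, hd]

/-- The action of `T_1 L_1 T_1 + T_1`, that is of `ξ L_2`. -/
def opY (ξ : Zˣ) (n : ℕ) (y : B) (X : N) (τ : ℕ → N) (φ : N →ₗ[Z] N) :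
    Module.End Z (Fin (n + 1) → N) :=
  opT ξ n τ 0 * opL ξ n y X τ φ * opT ξ n τ 0 + opT ξ n τ 0

theorem opY_zero (hn : 0 < n) (m : N) : opY ξ n y X τ φ (e Z n 0 m) =
    e Z n 1 ((((ξ : Z) - 1) • y + 1) • φ m) + (ξ : Z) • e Z n 0 (X * m) := by
  have h1 := fun m : N => opT_succ ξ n τ (r := 0) hn m
  have h2 := fun m : N => opL_succ ξ n y X τ φ (k := 0) hn m
  simp only [zero_add, desc, one_mul] at h1 h2
  simp (disch := omega) only [opY, Module.End.mul_apply, LinearMap.add_apply, opT_self, zero_add,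
    h1, h2, map_add, map_sub, add_smul, smul_assoc, one_smul, add_mul, smul_mul_assoc, one_mul,
    map_smul]
  module

theorem opY_one (hn : 0 < n) (m : N) : opY ξ n y X τ φ (e Z n 1 m) =
    e Z n 1 (((ξ : Z) - 1) • ((((ξ : Z) - 1) • y + 1) • φ m) + (ξ : Z) • (y • m))
      + (ξ : Z) • e Z n 0 ((((ξ : Z) - 1) • X + 1) * m) := by
  have h0 := opY_zero (ξ := ξ) (y := y) (X := X) (τ := τ) (φ := φ) hn m
  have h1 := fun m : N => opT_succ ξ n τ (r := 0) hn m
  simp only [zero_add] at h1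
  simp (disch := omega) only [opY, Module.End.mul_apply, LinearMap.add_apply, opT_self, zero_add,
    h1, map_add, map_smul, opL_zero, add_smul, smul_assoc, one_smul, add_mul, smul_mul_assoc,
    one_mul, smul_add] at h0 ⊢
  linear_combination (norm := module) ((ξ : Z) - 1) • h0

theorem opY_add_two {k : ℕ} (hk : k + 2 ≤ n) (m : N) : opY ξ n y X τ φ (e Z n (k + 2) m) =
    e Z n (k + 2) ((τ 0 * X * τ 0 + τ 0) * m)
      + e Z n 1 ((((ξ : Z) - 1) • y + 1) • (desc τ (k + 1) * φ (τ 0 * m))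
      - desc τ (k + 1) * ((((ξ : Z) - 1) • X + 1) * (τ 0 * m))) := by
  simp (disch := omega) only [opY, Module.End.mul_apply, LinearMap.add_apply, opT_gt, opL_succ,
    opT_self, map_add, add_mul, mul_assoc]
  abel

/-- The product `τ k ⋯ τ 1`. -/
def descOne {N : Type*} [Ring N] (τ : ℕ → N) : ℕ → N
  | 0 => 1
  | k + 1 => τ (k + 1) * descOne τ k

/-- Splitting off `τ 0` is useful because `descOne` involves only generators that commute with `X`
and pass through `φ`. -/
theorem desc_succ_eq (τ : ℕ → N) (k : ℕ) : desc τ (k + 1) = descOne τ k * τ 0 := by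
  induction k with
  | zero => simp [desc, descOne]
  | succ k ih => rw [desc, ih, descOne, mul_assoc]

/-- This is the one relation tying the chosen action of L_1 to that of T_1. Copies 0 and 1 are
direct; on higher copies the components in copies 1 and 0 are compared separately. -/
theorem opL_opY (h : IsEvalSystem ξ n f y X τ φ) (hn : 0 < n) :
    opL ξ n y X τ φ * opY ξ n y X τ φ = opY ξ n y X τ φ * opL ξ n y X τ φ := by
  have h2 := fun m : N => opL_succ ξ n y X τ φ (k := 0) hn m
  simp only [zero_add, desc, one_mul] at h2
  refine ext_e n fun k hk m => ?_
  simp only [Module.End.mul_apply]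
  match k, hk with
  | 0, _ =>
    simp only [opY_zero hn, opL_zero, map_add, map_sub, h2, map_smul, h.φ_y, h.φ_φ,
      add_smul, smul_assoc, one_smul, add_mul, mul_smul_comm, smul_mul_assoc, one_mul,
      smul_scalar_comm (N := N) y, smul_add]
    module
  | 1, _ =>
    simp only [opY_zero hn, opY_one hn, opL_zero, map_add, map_sub, h2, map_smul, h.φ_y, h.φ_φ,
      h.φ_X, add_smul, smul_assoc, one_smul, add_mul, mul_smul_comm, smul_mul_assoc,
      one_mul, smul_add, smul_sub, smul_scalar_comm (N := N) y]
    module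
  | k + 2, hk =>
    have hS : ∀ j, j + 1 < n → (∀ m, X * (descOne τ j * m) = descOne τ j * (X * m)) ∧
        (∀ m, φ (descOne τ j * m) = descOne τ j * φ m) := by
      intro j
      induction j with
      | zero => exact fun _ => ⟨fun m => by simp [descOne], fun m => by simp [descOne]⟩
      | succ j ih =>
        intro hj
        obtain ⟨i1, i2⟩ := ih (by omega)
        refine ⟨fun m => ?_, fun m => ?_⟩
        · rw [descOne, mul_assoc, ← mul_assoc X, h.sys.x_t _ (by omega) hj, mul_assoc, i1,
            mul_assoc]
        · rw [descOne, mul_assoc, h.φ_τ _ (by omega) hj, i2, mul_assoc]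
    obtain ⟨hSX, hSφ⟩ := hS k (by omega)
    have hxY := h.sys.x_y (by omega)
    have hφY := h.φ_Y (by omega)
    have hcomm := h.comm (by omega) m
    have hyc := smul_scalar_comm (Z := Z) (N := N) y
    have hY2 := opY_add_two (ξ := ξ) (y := y) (X := X) (τ := τ) (φ := φ) hk
    have htt : ∀ a, τ 0 * (τ 0 * a) = ((ξ : Z) - 1) • (τ 0 * a) + (ξ : Z) • a := fun a => by
      rw [← mul_assoc, h.sys.quad 0 (by omega), add_mul, smul_mul_assoc, smul_mul_assoc, one_mul]
    obtain ⟨Y, hY⟩ : ∃ Y, τ 0 * X * τ 0 + τ 0 = Y := ⟨_, rfl⟩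
    rw [hY] at hxY hφY hY2
    have hXY : ∀ a, X * (Y * a) = Y * (X * a) := fun a => by
      rw [← mul_assoc, hxY, mul_assoc]
    have htXt : ∀ a, τ 0 * (X * (τ 0 * a)) = Y * a - τ 0 * a := fun a => by
      rw [← hY]; noncomm_ring
    have htY : ∀ a, τ 0 * (Y * a) = ((ξ : Z) - 1) • (Y * a) + (ξ : Z) • (X * (τ 0 * a))
        + (ξ : Z) • a := fun a => by
      rw [← hY]
      simp only [add_mul, mul_add, mul_assoc, htt]
      module
    have hd : ∀ a, desc τ (k + 1) * a = descOne τ k * (τ 0 * a) := fun a => by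
      rw [desc_succ_eq, mul_assoc]
    -- Equality of the components in copy 1; it is the axiom `comm` multiplied by (ξ - 1) y + 1 and
    -- by `descOne τ k`.
    have H1 : X * ((((ξ : Z) - 1) • y + 1) • (desc τ (k + 1) * φ (τ 0 * m))
          - desc τ (k + 1) * ((((ξ : Z) - 1) • X + 1) * (τ 0 * m)))
        = (((ξ : Z) - 1) • y + 1) • (desc τ (k + 1) * φ (τ 0 * (X * m)))
          - desc τ (k + 1) * ((((ξ : Z) - 1) • X + 1) * (τ 0 * (X * m)))
        + (((ξ : Z) - 1) • y + 1) • φ ((((ξ : Z) - 1) • y + 1) • (desc τ (k + 1) * φ m)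
          - desc τ (k + 1) * ((((ξ : Z) - 1) • X + 1) * m)) := by
      have h1 := congrArg (fun z => descOne τ k * z) hcomm
      have h2 := congrArg (fun z => y • z) h1
      simp only [hd, hSX, hSφ, htt, htXt, hXY, h.φ_y, h.φ_τ_φ, map_add,
        map_sub, map_smul, add_smul, smul_assoc, one_smul, mul_add, mul_sub, add_mul,
        mul_smul_comm, smul_mul_assoc, one_mul, smul_add, smul_sub, hyc] at h1 h2 ⊢
      linear_combination (norm := module) ((ξ : Z) - 1) • h2 + h1
    -- Equality of the components in copy 0.
    have H0 : (((ξ : Z) - 1) • y + 1) • (desc τ (k + 1) * φ (Y * m))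
          - desc τ (k + 1) * ((((ξ : Z) - 1) • X + 1) * (Y * m))
        + ((((ξ : Z) - 1) • y + 1) • φ ((((ξ : Z) - 1) • y + 1) • (desc τ (k + 1) * φ (τ 0 * m))
          - desc τ (k + 1) * ((((ξ : Z) - 1) • X + 1) * (τ 0 * m)))
        - (((ξ : Z) - 1) • X + 1) * ((((ξ : Z) - 1) • y + 1) • (desc τ (k + 1) * φ (τ 0 * m))
          - desc τ (k + 1) * ((((ξ : Z) - 1) • X + 1) * (τ 0 * m))))
        = (ξ : Z) • (X * ((((ξ : Z) - 1) • y + 1) • (desc τ (k + 1) * φ m)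
          - desc τ (k + 1) * ((((ξ : Z) - 1) • X + 1) * m))) := by
      simp only [hd, hSX, hSφ, htt, htXt, htY, hXY, hφY, h.φ_y, h.φ_τ_φ, map_add,
        map_sub, map_smul, add_smul, smul_assoc, one_smul, mul_add, mul_sub, add_mul,
        mul_smul_comm, smul_mul_assoc, one_mul, smul_add, smul_sub, hyc]
      module
    rw [hY2, opL_succ ξ n y X τ φ hk, map_add, map_add, opL_succ ξ n y X τ φ hk, h2, hY2,
      opY_zero hn, H1, hXY, ← map_smul (e Z n 0), ← H0]
    simp only [map_add]
    abel

/-- The operators of `T_1, …, T_n` and `L_1` form a Hecke system. -/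
theorem isHeckeSystem (h : IsEvalSystem ξ n f y X τ φ) :
    IsHeckeSystem ξ (n + 1) (opL ξ n y X τ φ) (opT (Z := Z) ξ n τ) where
  quad := (isHeckeSystem_opT h.sys).1
  far := (isHeckeSystem_opT h.sys).2.1
  braid := (isHeckeSystem_opT h.sys).2.2
  x_t r h0 hr := by
    obtain ⟨r, rfl⟩ : ∃ s, r = s + 1 := ⟨r - 1, by omega⟩
    exact opL_opT h (by omega)
  x_y hn := opL_opY h (by omega)

/-! ### The cyclotomic relation on the induced module. -/

theorem aeval_opL_e_zero (p : Polynomial Z) (m : N) :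
    p.aeval (opL ξ n y X τ φ) (e Z n 0 m) = e Z n 0 (p.aeval y • m) := by
  induction p using Polynomial.induction_on generalizing m with
  | C a => simp [Algebra.algebraMap_eq_smul_one]
  | add p q hp hq => simp only [map_add, LinearMap.add_apply, hp, hq, add_smul]
  | monomial k a ih =>
    rw [pow_succ, ← mul_assoc, map_mul, map_mul _ _ Polynomial.X, Polynomial.aeval_X,
      Polynomial.aeval_X, Module.End.mul_apply, opL_zero, ih, mul_smul]

/-- On copy 0, L_1 acts as y, a root of f. The vanishing of F = f(L_1) then spreads to copy 1
through Y, and to the other copies through the T_r, because F commutes with all these operators. -/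
theorem aeval_opL (h : IsEvalSystem ξ n f y X τ φ) : f.aeval (opL ξ n y X τ φ) = 0 := by
  set F := f.aeval (opL ξ n y X τ φ) with hF
  have h0 : ∀ m, F (e Z n 0 m) = 0 := fun m => by
    rw [hF, aeval_opL_e_zero, h.aeval_y, zero_smul, map_zero]
  rcases Nat.eq_zero_or_pos n with rfl | hn
  · refine ext_e 0 fun k hk m => ?_
    obtain rfl : k = 0 := by omega
    rw [h0, LinearMap.zero_apply]
  have hcomm : ∀ a : Module.End Z (Fin (n + 1) → N), Commute a (opL ξ n y X τ φ) →
      ∀ v, F (a v) = a (F v) := fun a ha v =>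
    (LinearMap.congr_fun (commute_aeval ha f) v).symm
  have hY := hcomm _ (show Commute (opY ξ n y X τ φ) _ from (opL_opY h hn).symm)
  have hφ : ∀ m, F (e Z n 1 (φ m)) = 0 := by
    have h2 := fun m : N => opL_succ ξ n y X τ φ (k := 0) hn m
    simp only [zero_add, desc, one_mul] at h2
    -- On copy 0, c is ξ T_1⁻¹. On values of φ it strips the leading T_1 from T_1 ⋯ T_n, so L_1
    -- passes through to `X`, which is also a root of f.
    let c : N →ₗ[Z] (Fin (n + 1) → N) := e Z n 1 - ((ξ : Z) - 1) • e Z n 0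
    have hz : ∀ m, opL ξ n y X τ φ (c (φ m)) = c (X * φ m) := fun m => by
      simp only [c, LinearMap.sub_apply, LinearMap.smul_apply, map_sub, map_smul, h2, opL_zero,
        h.φ_φ, add_smul, add_mul, smul_assoc, one_smul, smul_mul_assoc, one_mul, map_add]
      module
    have hp : ∀ (p : Polynomial Z) m, p.aeval (opL ξ n y X τ φ) (c (φ m))
        = c (p.aeval X * φ m) := fun p => by
      induction p using Polynomial.induction_on with
      | C a => intro m; simp [Algebra.algebraMap_eq_smul_one]
      | add p q hp hq =>
        intro m
        simp only [map_add, LinearMap.add_apply, hp, hq, add_mul]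
      | monomial k a ih =>
        intro m
        rw [pow_succ, ← mul_assoc, map_mul, map_mul _ _ Polynomial.X, Polynomial.aeval_X,
          Polynomial.aeval_X, Module.End.mul_apply, hz, ← h.φ_X, ih, h.φ_X, mul_assoc]
    intro m
    have := hp f m
    rw [h.aeval_X, zero_mul, map_zero, ← hF, LinearMap.sub_apply, map_sub, LinearMap.smul_apply,
      map_smul, h0, smul_zero, sub_zero] at this
    exact this
  have hyφ : ∀ m, F (e Z n 1 ((((ξ : Z) - 1) • y + 1) • φ m)) = 0 := fun m => by
    have := hY (e Z n 0 m)
    rwa [opY_zero hn, map_add, F.map_smul, h0, h0, map_zero, smul_zero, add_zero] at this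
  -- Applying Y to copy 1 shows that the kernel of F there is stable under y. It contains the values
  -- of φ, so it is everything.
  have h1 : ∀ m, F (e Z n 1 m) = 0 := by
    have := h.span (LinearMap.ker (F ∘ₗ e Z n 1)) hφ fun m hm => by
      have hm' : F (e Z n 1 m) = 0 := hm
      have := hY (e Z n 1 m)
      rw [opY_one hn, map_add, map_add, map_add, (e Z n 1).map_smul, (e Z n 1).map_smul,
        F.map_smul, F.map_smul, F.map_smul, h0, hyφ, hm', map_zero, smul_zero, smul_zero, add_zero, zero_add] at this
      exact IsHeckeSystem.smul_cancel ξ (this.trans (smul_zero _).symm)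
    intro m
    have hm : m ∈ LinearMap.ker (F ∘ₗ e Z n 1) := this ▸ Submodule.mem_top
    exact hm
  have hk : ∀ k, k + 1 ≤ n → ∀ m, F (e Z n (k + 1) m) = 0 := fun k => by
    induction k with
    | zero => exact fun _ => h1
    | succ k ih =>
      intro hk m
      rw [← opT_self ξ n τ (by omega), hcomm _ (show Commute _ _ from (opL_opT h (by omega)).symm),
        ih (by omega), map_zero]
  refine ext_e n fun k hkn m => ?_
  rcases k with _ | k
  · rw [h0, LinearMap.zero_apply]
  · rw [hk k hkn, LinearMap.zero_apply]

end IndModule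

/-! ### The tensor product of Z[y]/(f) with a Hecke system. -/

open scoped TensorProduct

/-- Evaluation of `AdjoinRoot f` at a root of `f` in a noncommutative algebra. -/
noncomputable def evalRoot {Z A : Type*} [CommRing Z] [Ring A] [Algebra Z A] {f : Polynomial Z} {x : A}
    (hx : f.aeval x = 0) : AdjoinRoot f →ₐ[Z] A where
  __ := Ideal.Quotient.lift (Ideal.span {f}) (Polynomial.aeval (R := Z) x).toRingHom fun g hg => by
    obtain ⟨q, rfl⟩ := Ideal.mem_span_singleton'.mp hg
    change Polynomial.aeval x (q * f) = 0
    rw [map_mul, hx, mul_zero]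
  commutes' r := Polynomial.aeval_C x r

theorem evalRoot_mk {Z A : Type*} [CommRing Z] [Ring A] [Algebra Z A] {f : Polynomial Z} {x : A}
    (hx : f.aeval x = 0) (p : Polynomial Z) : evalRoot hx (AdjoinRoot.mk f p) = p.aeval x :=
  rfl

theorem evalRoot_root {Z A : Type*} [CommRing Z] [Ring A] [Algebra Z A] {f : Polynomial Z} {x : A}
    (hx : f.aeval x = 0) : evalRoot hx (AdjoinRoot.root f) = x :=
  (evalRoot_mk hx _).trans (Polynomial.aeval_X x)

theorem commute_evalRoot {Z A : Type*} [CommRing Z] [Ring A] [Algebra Z A] {f : Polynomial Z}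
    {x : A} (hx : f.aeval x = 0) {a : A} (h : Commute a x) (b : AdjoinRoot f) :
    Commute a (evalRoot hx b) := by
  obtain ⟨p, rfl⟩ := AdjoinRoot.mk_surjective b
  exact commute_aeval h p

namespace IsHeckeSystem

variable {Z A : Type*} [CommRing Z] [Ring A] [Algebra Z A] {ξ : Zˣ} {n : ℕ} {x : A} {t : ℕ → A}

theorem map {A' : Type*} [Ring A'] [Algebra Z A'] (h : IsHeckeSystem ξ n x t) (g : A →ₐ[Z] A') :
    IsHeckeSystem ξ n (g x) (fun r => g (t r)) where
  quad r hr := by simpa using congrArg g (h.quad r hr)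
  far r s hr hs := by simpa using congrArg g (h.far r s hr hs)
  braid r hr := by simpa using congrArg g (h.braid r hr)
  x_t r h0 hr := by simpa using congrArg g (h.x_t r h0 hr)
  x_y hn := by simpa using congrArg g (h.x_y hn)

/-- The map `b ⊗ a ↦ 1 ⊗ b(x) a`. -/
noncomputable def evalLeft {f : Polynomial Z} (hx : f.aeval x = 0) :
    AdjoinRoot f ⊗[Z] A →ₗ[Z] AdjoinRoot f ⊗[Z] A :=
  (Algebra.TensorProduct.includeRight : A →ₐ[Z] AdjoinRoot f ⊗[Z] A).toLinearMap ∘ₗ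
    LinearMap.mul' Z A ∘ₗ TensorProduct.map (evalRoot hx).toLinearMap LinearMap.id

theorem evalLeft_tmul {f : Polynomial Z} (hx : f.aeval x = 0) (b : AdjoinRoot f) (a : A) :
    evalLeft hx (b ⊗ₜ a) = 1 ⊗ₜ (evalRoot hx b * a) :=
  rfl

/-- What commutes with x commutes with b(x); this gives the axioms moving factors through φ. `comm`
is `x_mul_t_p_t`, and `span` holds because 1 ⊗ a is its own value under φ and the powers of y
generate Z[y]/(f). -/
theorem isEvalSystem {f : Polynomial Z} (h : IsHeckeSystem ξ n x t) (hx : f.aeval x = 0) :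
    IsEvalSystem ξ n f (AdjoinRoot.root f) ((1 : AdjoinRoot f) ⊗ₜ[Z] x)
      (fun r => (1 : AdjoinRoot f) ⊗ₜ[Z] t r) (evalLeft hx) where
  sys := h.map (Algebra.TensorProduct.includeRight : A →ₐ[Z] AdjoinRoot f ⊗[Z] A)
  aeval_y := by rw [AdjoinRoot.aeval_eq, AdjoinRoot.mk_self]
  aeval_X := by
    have := Polynomial.aeval_algHom_apply
      (Algebra.TensorProduct.includeRight : A →ₐ[Z] AdjoinRoot f ⊗[Z] A) x f
    rwa [hx, map_zero] at this
  φ_y m := by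
    induction m with
    | zero => simp
    | add a b ha hb => rw [smul_add, map_add, map_add, mul_add, ha, hb]
    | tmul b a =>
      rw [TensorProduct.smul_tmul', evalLeft_tmul, evalLeft_tmul, smul_eq_mul, map_mul,
        evalRoot_root, Algebra.TensorProduct.tmul_mul_tmul, one_mul, mul_assoc]
  φ_X m := by
    induction m with
    | zero => simp
    | add a b ha hb => rw [mul_add, map_add, map_add, mul_add, ha, hb]
    | tmul b a =>
      rw [Algebra.TensorProduct.tmul_mul_tmul, evalLeft_tmul, evalLeft_tmul,
        Algebra.TensorProduct.tmul_mul_tmul, one_mul, one_mul, ← mul_assoc, ← mul_assoc,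
        (commute_evalRoot hx (Commute.refl x) b).eq]
  φ_τ r h0 hr m := by
    induction m with
    | zero => simp
    | add a b ha hb => rw [mul_add, map_add, map_add, mul_add, ha, hb]
    | tmul b a =>
      rw [Algebra.TensorProduct.tmul_mul_tmul, evalLeft_tmul, evalLeft_tmul,
        Algebra.TensorProduct.tmul_mul_tmul, one_mul, one_mul, ← mul_assoc, ← mul_assoc,
        (commute_evalRoot hx (show Commute (t r) x from (h.x_t r h0 hr).symm) b).eq]
  φ_φ m := by
    induction m with
    | zero => simp
    | add a b ha hb => rw [map_add, map_add, ha, hb]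
    | tmul b a => rw [evalLeft_tmul, evalLeft_tmul, map_one, one_mul]
  φ_τ_φ m := by
    induction m with
    | zero => simp
    | add a b ha hb => rw [map_add, mul_add, map_add, ha, hb]
    | tmul b a =>
      rw [evalLeft_tmul, Algebra.TensorProduct.tmul_mul_tmul, evalLeft_tmul, one_mul, map_one,
        one_mul]
  φ_Y hn m := by
    have hY : (1 : AdjoinRoot f) ⊗ₜ[Z] t 0 * 1 ⊗ₜ[Z] x * 1 ⊗ₜ[Z] t 0 + 1 ⊗ₜ[Z] t 0
        = 1 ⊗ₜ[Z] (t 0 * x * t 0 + t 0) := by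
      simp only [Algebra.TensorProduct.tmul_mul_tmul, one_mul, TensorProduct.tmul_add]
    rw [hY]
    induction m with
    | zero => simp
    | add a b ha hb => rw [mul_add, map_add, map_add, mul_add, ha, hb]
    | tmul b a =>
      rw [Algebra.TensorProduct.tmul_mul_tmul, evalLeft_tmul, evalLeft_tmul,
        Algebra.TensorProduct.tmul_mul_tmul, one_mul, one_mul, ← mul_assoc, ← mul_assoc,
        (commute_evalRoot hx (show Commute (t 0 * x * t 0 + t 0) x from (h.x_y hn).symm) b).eq]
  comm hn m := by
    have hX : ((ξ : Z) - 1) • ((1 : AdjoinRoot f) ⊗ₜ[Z] x) + 1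
        = 1 ⊗ₜ[Z] (((ξ : Z) - 1) • x + 1) := by
      rw [TensorProduct.tmul_add, TensorProduct.tmul_smul, Algebra.TensorProduct.one_def]
    rw [hX]
    induction m with
    | zero => simp
    | add a b ha hb =>
      simp only [mul_add, map_add, ha, hb]
      abel
    | tmul b a =>
      obtain ⟨p, rfl⟩ := AdjoinRoot.mk_surjective b
      have := congrArg (fun z => (1 : AdjoinRoot f) ⊗ₜ[Z] (z * a)) (h.x_mul_t_p_t hn p)
      simp only [Algebra.TensorProduct.tmul_mul_tmul, evalLeft_tmul, evalRoot_mk, one_mul,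
        ← TensorProduct.tmul_add, ← TensorProduct.tmul_sub]
      simpa only [add_mul (_ + _), sub_mul, add_mul _ _ a, mul_assoc] using this
  span K h1 h2 := by
    refine eq_top_iff.mpr fun m _ => ?_
    induction m with
    | zero => exact K.zero_mem
    | add a b ha hb => exact K.add_mem (ha trivial) (hb trivial)
    | tmul b a =>
      obtain ⟨p, rfl⟩ := AdjoinRoot.mk_surjective b
      induction p using Polynomial.induction_on with
      | C c =>
        have := K.smul_mem c (h1 (1 ⊗ₜ a))
        rwa [evalLeft_tmul, map_one, one_mul, TensorProduct.smul_tmul', Algebra.smul_def,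
          mul_one] at this
      | add p q hp hq =>
        rw [map_add, TensorProduct.add_tmul]
        exact K.add_mem (hp trivial) (hq trivial)
      | monomial k c ih =>
        have := h2 _ (ih trivial)
        rw [TensorProduct.smul_tmul', smul_eq_mul] at this
        rwa [pow_succ, ← mul_assoc, map_mul, AdjoinRoot.mk_X, mul_comm]

end IsHeckeSystem

/-- For monic f, Z[y]/(f) is free, hence flat, so tensoring preserves injectivity of multiplication
by c. -/
theorem smul_eq_zero_tensor {Z A : Type*} [CommRing Z] [Ring A] [Algebra Z A] {f : Polynomial Z}
    (hf : f.Monic) {c : Z} (hc : ∀ a : A, c • a = 0 → a = 0) (m : AdjoinRoot f ⊗[Z] A)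
    (hm : c • m = 0) : m = 0 := by
  have := hf.free_adjoinRoot
  have hinj : Function.Injective (LinearMap.lsmul Z A c) :=
    (injective_iff_map_eq_zero _).mpr hc
  have h1 := Module.Flat.lTensor_preserves_injective_linearMap (M := AdjoinRoot f) _ hinj
  have h2 : ∀ m, LinearMap.lTensor (AdjoinRoot f) (LinearMap.lsmul Z A c) m = c • m := by
    intro m
    induction m with
    | zero => simp
    | add a b ha hb => rw [map_add, ha, hb, smul_add]
    | tmul b a => simp
  exact h1 (by rw [h2, hm, map_zero])

/-! ### The equivariant map from the induced module to the larger algebra. -/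

namespace IndModule

/-- The ascending product `T_0 ⋯ T_(k-1)`. -/
def asc {A : Type*} [Ring A] (t : ℕ → A) : ℕ → A
  | 0 => 1
  | k + 1 => asc t k * t k

variable {Z A A' : Type*} [CommRing Z] [Ring A] [Algebra Z A] [Ring A'] [Algebra Z A']
    {ξ : Zˣ} {n : ℕ} {x : A} {t : ℕ → A} {x' : A'} {t' : ℕ → A'} {f : Polynomial Z}

theorem mul_asc_of_lt (h : IsHeckeSystem ξ n x t) {r k : ℕ} (hr : k < r) (hn : r + 1 < n) :
    t r * asc t k = asc t k * t r := by
  induction k with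
  | zero => simp [asc]
  | succ k ih =>
    rw [asc, ← mul_assoc, ih (by omega), mul_assoc, mul_assoc, h.far k r (by omega) hn]

theorem mul_asc_of_gt (h : IsHeckeSystem ξ n x t) {r k : ℕ} (hr : r + 1 < k) (hn : k < n) :
    t (r + 1) * asc t k = asc t k * t r := by
  induction k with
  | zero => omega
  | succ k ih =>
    rcases eq_or_ne k (r + 1) with rfl | hk
    · have hb := h.braid r (by omega)
      rw [asc, asc, ← mul_assoc, ← mul_assoc, mul_asc_of_lt h (by omega) (by omega)]
      rw [mul_assoc, mul_assoc, mul_assoc, mul_assoc, ← mul_assoc (t (r + 1)), ← hb]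
      simp only [mul_assoc]
    · rw [asc, ← mul_assoc, ih (by omega) (by omega), mul_assoc, mul_assoc,
        h.far r k (by omega) (by omega)]

/-- The factor a is the product of `t 1` to `t k`. Isolating `t 0` brings the ascending product into
the form needed by `x_mul_t_p_t`. -/
theorem exists_asc_eq (h : IsHeckeSystem ξ n x t) {k : ℕ} (hk : k + 1 < n) :
    ∃ a, asc t (k + 1) = t 0 * a ∧ Commute a x := by
  induction k with
  | zero => exact ⟨1, by simp [asc], Commute.one_left x⟩
  | succ k ih =>
    obtain ⟨a, ha, hax⟩ := ih (by omega)
    refine ⟨a * t (k + 1), by rw [asc, ha, mul_assoc], hax.mul_left ?_⟩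
    exact (h.x_t (k + 1) (by omega) hk).symm

/-- The map `b ⊗ a ↦ b(x') T_1 ⋯ T_n ι(a)`. -/
noncomputable def sandwich (hx' : f.aeval x' = 0) (t' : ℕ → A') (n : ℕ) (ι : A →ₐ[Z] A') :
    AdjoinRoot f ⊗[Z] A →ₗ[Z] A' :=
  LinearMap.mul' Z A' ∘ₗ TensorProduct.map (evalRoot hx').toLinearMap
    (LinearMap.mulLeft Z (asc t' n) ∘ₗ ι.toLinearMap)

theorem sandwich_tmul (hx' : f.aeval x' = 0) (ι : A →ₐ[Z] A') (b : AdjoinRoot f) (a : A) :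
    sandwich hx' t' n ι (b ⊗ₜ a) = evalRoot hx' b * (asc t' n * ι a) :=
  rfl

theorem sandwich_root (hx' : f.aeval x' = 0) (ι : A →ₐ[Z] A') (m : AdjoinRoot f ⊗[Z] A) :
    sandwich hx' t' n ι (AdjoinRoot.root f • m) = x' * sandwich hx' t' n ι m := by
  induction m with
  | zero => simp
  | add a b ha hb => rw [smul_add, map_add, map_add, mul_add, ha, hb]
  | tmul b a =>
    rw [TensorProduct.smul_tmul', sandwich_tmul, sandwich_tmul, smul_eq_mul, map_mul,
      evalRoot_root, mul_assoc]

theorem sandwich_t (h' : IsHeckeSystem ξ (n + 1) x' t') (hx' : f.aeval x' = 0) (ι : A →ₐ[Z] A')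
    (hιt : ∀ r, r + 1 < n → ι (t r) = t' r) {r : ℕ} (hr : r + 1 < n) (m : AdjoinRoot f ⊗[Z] A) :
    sandwich hx' t' n ι (1 ⊗ₜ t r * m) = t' (r + 1) * sandwich hx' t' n ι m := by
  induction m with
  | zero => simp
  | add a b ha hb => rw [mul_add, map_add, map_add, mul_add, ha, hb]
  | tmul b a =>
    have hc := commute_evalRoot hx' (h'.x_t (r + 1) (by omega) (by omega)).symm b
    rw [Algebra.TensorProduct.tmul_mul_tmul, one_mul, sandwich_tmul, sandwich_tmul, map_mul,
      hιt r hr, ← mul_assoc (asc t' n), ← mul_asc_of_gt h' hr (by omega), ← mul_assoc (t' (r + 1)),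
      hc.eq]
    simp only [mul_assoc]

theorem sandwich_desc (h' : IsHeckeSystem ξ (n + 1) x' t') (hx' : f.aeval x' = 0)
    (ι : A →ₐ[Z] A') (hιt : ∀ r, r + 1 < n → ι (t r) = t' r) {k : ℕ} (hk : k < n)
    (m : AdjoinRoot f ⊗[Z] A) :
    sandwich hx' t' n ι (desc (fun r => (1 : AdjoinRoot f) ⊗ₜ[Z] t r) k * m)
      = descOne t' k * sandwich hx' t' n ι m := by
  induction k with
  | zero => rw [desc, descOne, one_mul, one_mul]
  | succ k ih =>
    rw [desc, descOne, mul_assoc, sandwich_t h' hx' ι hιt (by omega), ih (by omega), mul_assoc]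

/-- With `asc t' n` = `t' 0` c and c commuting with x', this is `x_mul_t_p_t` multiplied on the
right by c ι(a). -/
theorem mul_t_mul_sandwich (h' : IsHeckeSystem ξ (n + 1) x' t') (hn : 0 < n) (hx : f.aeval x = 0)
    (hx' : f.aeval x' = 0) (ι : A →ₐ[Z] A') (hιx : ι x = x') (m : AdjoinRoot f ⊗[Z] A) :
    x' * (t' 0 * sandwich hx' t' n ι m) = t' 0 * sandwich hx' t' n ι (1 ⊗ₜ x * m)
      + (((ξ : Z) - 1) • x' + 1) * sandwich hx' t' n ι (IsHeckeSystem.evalLeft hx m)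
      - sandwich hx' t' n ι ((((ξ : Z) - 1) • (1 ⊗ₜ x) + 1) * m) := by
  have hX : ((ξ : Z) - 1) • ((1 : AdjoinRoot f) ⊗ₜ[Z] x) + 1
      = 1 ⊗ₜ[Z] (((ξ : Z) - 1) • x + 1) := by
    rw [TensorProduct.tmul_add, TensorProduct.tmul_smul, Algebra.TensorProduct.one_def]
  rw [hX]
  induction m with
  | zero => simp
  | add a b ha hb =>
    simp only [mul_add, map_add, ha, hb]
    abel
  | tmul b a =>
    obtain ⟨p, rfl⟩ := AdjoinRoot.mk_surjective b
    obtain ⟨k, rfl⟩ : ∃ k, n = k + 1 := ⟨n - 1, by omega⟩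
    obtain ⟨c, hc, hcx⟩ := exists_asc_eq h' (k := k) (by omega)
    have hcp : c * p.aeval x' = p.aeval x' * c := commute_aeval hcx p
    have hιp : ι (p.aeval x) = p.aeval x' := by rw [← Polynomial.aeval_algHom_apply, hιx]
    have hcx' : ∀ z, c * (x' * z) = x' * (c * z) := fun z => by
      rw [← mul_assoc, hcx.eq, mul_assoc]
    have hcp' : ∀ z, c * (p.aeval x' * z) = p.aeval x' * (c * z) := fun z => by
      rw [← mul_assoc, hcp, mul_assoc]
    have := congrArg (fun z => z * (c * ι a)) (h'.x_mul_t_p_t (by omega) p)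
    simp only [Algebra.TensorProduct.tmul_mul_tmul, IsHeckeSystem.evalLeft_tmul, sandwich_tmul,
      evalRoot_mk, one_mul, map_one, map_mul, map_add, map_smul, hιx, hιp, hc, mul_assoc, add_mul,
      mul_add, sub_mul, smul_mul_assoc, mul_smul_comm, hcx', hcp', mul_one] at this ⊢
    exact this

/-- This identity is the source of the formula for `opL`: the preceding one multiplied by `descOne
t' k`, which commutes with x'. -/
theorem desc_mul_sandwich (h' : IsHeckeSystem ξ (n + 1) x' t') (hx : f.aeval x = 0)
    (hx' : f.aeval x' = 0) (ι : A →ₐ[Z] A') (hιx : ι x = x')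
    (hιt : ∀ r, r + 1 < n → ι (t r) = t' r) {k : ℕ} (hk : k < n) (m : AdjoinRoot f ⊗[Z] A) :
    x' * (desc t' (k + 1) * sandwich hx' t' n ι m)
      = desc t' (k + 1) * sandwich hx' t' n ι (1 ⊗ₜ x * m)
      + sandwich hx' t' n ι ((((ξ : Z) - 1) • AdjoinRoot.root f + 1) •
          (desc (fun r => (1 : AdjoinRoot f) ⊗ₜ[Z] t r) k * IsHeckeSystem.evalLeft hx m)
        - desc (fun r => (1 : AdjoinRoot f) ⊗ₜ[Z] t r) k *
          ((((ξ : Z) - 1) • (1 ⊗ₜ x) + 1) * m)) := by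
  have hS : ∀ j, j < n → ∀ z, x' * (descOne t' j * z) = descOne t' j * (x' * z) := by
    intro j
    induction j with
    | zero => intro _ z; simp [descOne]
    | succ j ih =>
      intro hj z
      rw [descOne, mul_assoc, ← mul_assoc x', h'.x_t _ (by omega) (by omega), mul_assoc,
        ih (by omega), mul_assoc]
  have key := congrArg (fun z => descOne t' k * z)
    (mul_t_mul_sandwich h' (by omega) hx hx' ι hιx m)
  rw [map_sub, add_smul, one_smul, smul_assoc, map_add, map_smul, sandwich_root,
    sandwich_desc h' hx' ι hιt hk, sandwich_desc h' hx' ι hιt hk, desc_succ_eq]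
  simp only [mul_assoc, hS k hk, mul_add, mul_sub, add_mul, smul_mul_assoc, mul_smul_comm,
    one_mul] at key ⊢
  rw [key]
  abel

/-- The map `(m_k)_k ↦ ∑ T_k ⋯ T_1 θ(m_k)`, where `θ` is `sandwich`. -/
noncomputable def toAlg (hx' : f.aeval x' = 0) (t' : ℕ → A') (n : ℕ) (ι : A →ₐ[Z] A') :
    (Fin (n + 1) → AdjoinRoot f ⊗[Z] A) →ₗ[Z] A' :=
  sumMap n fun k => LinearMap.mulLeft Z (desc t' k) ∘ₗ sandwich hx' t' n ι

theorem toAlg_e (hx' : f.aeval x' = 0) (ι : A →ₐ[Z] A') {k : ℕ} (hk : k ≤ n)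
    (m : AdjoinRoot f ⊗[Z] A) :
    toAlg hx' t' n ι (e Z n k m) = desc t' k * sandwich hx' t' n ι m := by
  rw [toAlg, sumMap_e n _ hk]
  rfl

theorem toAlg_opT (h' : IsHeckeSystem ξ (n + 1) x' t') (hx' : f.aeval x' = 0) (ι : A →ₐ[Z] A')
    (hιt : ∀ r, r + 1 < n → ι (t r) = t' r) {r : ℕ} (hr : r < n)
    (v : Fin (n + 1) → AdjoinRoot f ⊗[Z] A) :
    toAlg hx' t' n ι (opT (Z := Z) ξ n (fun r => (1 : AdjoinRoot f) ⊗ₜ[Z] t r) r v)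
      = t' r * toAlg hx' t' n ι v := by
  suffices H : toAlg hx' t' n ι ∘ₗ opT (Z := Z) ξ n (fun r => (1 : AdjoinRoot f) ⊗ₜ[Z] t r) r
      = LinearMap.mulLeft Z (t' r) ∘ₗ toAlg hx' t' n ι from LinearMap.congr_fun H v
  refine ext_e n fun k hk m => ?_
  simp only [LinearMap.comp_apply, LinearMap.mulLeft_apply]
  obtain hc | rfl | rfl | hc : k < r ∨ k = r ∨ k = r + 1 ∨ r + 1 < k := by omega
  · obtain ⟨r, rfl⟩ : ∃ s, r = s + 1 := ⟨r - 1, by omega⟩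
    rw [opT_lt _ _ _ hc hk, toAlg_e hx' ι hk, toAlg_e hx' ι hk, Nat.add_sub_cancel,
      sandwich_t h' hx' ι hιt (by omega), ← mul_assoc, ← mul_assoc,
      mul_desc_of_lt h' hc (by omega)]
  · rw [opT_self _ _ _ hk, toAlg_e hx' ι (by omega), toAlg_e hx' ι hk, desc, mul_assoc]
  · rw [opT_succ _ _ _ hk, map_add, map_smul, map_smul, toAlg_e hx' ι hk,
      toAlg_e hx' ι (by omega : r ≤ n), desc, ← mul_assoc, ← mul_assoc, h'.quad r (by omega)]
    simp only [add_mul, smul_mul_assoc, one_mul, mul_assoc]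
  · rw [opT_gt _ _ _ hc hk, toAlg_e hx' ι hk, toAlg_e hx' ι hk,
      sandwich_t h' hx' ι hιt (by omega), ← mul_assoc, ← mul_assoc,
      mul_desc_of_gt h' hc (by omega)]

theorem toAlg_opL (h' : IsHeckeSystem ξ (n + 1) x' t') (hx : f.aeval x = 0)
    (hx' : f.aeval x' = 0) (ι : A →ₐ[Z] A') (hιx : ι x = x')
    (hιt : ∀ r, r + 1 < n → ι (t r) = t' r) (v : Fin (n + 1) → AdjoinRoot f ⊗[Z] A) :
    toAlg hx' t' n ι (opL ξ n (AdjoinRoot.root f) (1 ⊗ₜ x)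
        (fun r => (1 : AdjoinRoot f) ⊗ₜ[Z] t r) (IsHeckeSystem.evalLeft hx) v)
      = x' * toAlg hx' t' n ι v := by
  suffices H : toAlg hx' t' n ι ∘ₗ opL ξ n (AdjoinRoot.root f) (1 ⊗ₜ x)
        (fun r => (1 : AdjoinRoot f) ⊗ₜ[Z] t r) (IsHeckeSystem.evalLeft hx)
      = LinearMap.mulLeft Z x' ∘ₗ toAlg hx' t' n ι from LinearMap.congr_fun H v
  refine ext_e n fun k hk m => ?_
  simp only [LinearMap.comp_apply, LinearMap.mulLeft_apply]
  rcases k with _ | k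
  · rw [opL_zero, toAlg_e hx' ι hk, toAlg_e hx' ι hk, sandwich_root, desc, one_mul, one_mul]
  · rw [opL_succ _ _ _ _ _ _ hk, map_add, toAlg_e hx' ι hk, toAlg_e hx' ι (by omega),
      toAlg_e hx' ι hk, desc_mul_sandwich h' hx hx' ι hιx hιt (by omega), desc, one_mul]

end IndModule

/-! ### Torsion-freeness by induction on n. -/

namespace CyclotomicHecke

variable {Z : Type*} [CommRing Z] {l : ℕ} (ξ : Zˣ) (κ : Fin l → ℤ)

-- An element killed by c sends the vector 1 in copy 0 to zero, since c acts injectively on the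
-- module; equivariance turns this into a T_1 ⋯ T_n = 0 with T_1 ⋯ T_n invertible.
open IndModule in
theorem smul_eq_zero_succ {n : ℕ} [NeZero n] {c : Z}
    (hc : ∀ a : CyclotomicHecke n ξ κ, c • a = 0 → a = 0)
    (a : CyclotomicHecke (n + 1) ξ κ) (ha : c • a = 0) : a = 0 := by
  have hx := aeval_L_zero (n := n) ξ κ
  have hx' := aeval_L_zero (n := n + 1) ξ κ
  have h' := isHeckeSystem (n + 1) ξ κ
  have hE := (isHeckeSystem n ξ κ).isEvalSystem hx
  obtain ⟨ι, hιx, hιT⟩ := exists_lift (n := n) ξ κ (h'.mono (Nat.le_succ n)) hx'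
  have hιt : ∀ r, r + 1 < n → ι (tSeq n ξ κ r) = tSeq (n + 1) ξ κ r := fun r hr => by
    rw [← hιT ⟨r, by omega⟩, ← tSeq_val]
  obtain ⟨Φ, hΦL, hΦT⟩ := exists_lift (n := n + 1) ξ κ (IndModule.isHeckeSystem hE)
    (aeval_opL hE)
  let ψ := toAlg hx' (tSeq (n + 1) ξ κ) n ι
  -- Equivariance of ψ holds on a subalgebra, so checking it on L_1 and the T_r is enough.
  let S : Subalgebra Z (CyclotomicHecke (n + 1) ξ κ) :=
    { carrier := {b | ∀ v, ψ (Φ b v) = b * ψ v}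
      mul_mem' := fun {b d} hb hd v => by
        rw [map_mul, Module.End.mul_apply, hb, hd, mul_assoc]
      add_mem' := fun {b d} hb hd v => by
        rw [map_add, LinearMap.add_apply, map_add, hb, hd, add_mul]
      algebraMap_mem' := fun z v => by
        rw [AlgHom.commutes, Module.algebraMap_end_apply, map_smul, Algebra.smul_def] }
  have hS : S = ⊤ := subalgebra_eq_top ξ κ
    (fun v => by rw [hΦL]; exact toAlg_opL h' hx hx' ι hιx hιt v)
    (fun r v => by
      rw [hΦT, ← tSeq_val]
      exact toAlg_opT h' hx' ι hιt r.isLt v)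
  have haS : ∀ v, ψ (Φ a v) = a * ψ v := (hS ▸ Algebra.mem_top : a ∈ S)
  have h0 : Φ a (e Z n 0 1) = 0 := by
    have h1 : c • Φ a (e Z n 0 1) = 0 := by
      rw [← LinearMap.smul_apply, ← map_smul, ha, map_zero, LinearMap.zero_apply]
    funext i
    exact smul_eq_zero_tensor (cycPoly_monic ξ κ) hc _ (congrFun h1 i)
  have hu : ∀ k, k ≤ n → IsUnit (asc (tSeq (n + 1) ξ κ) k) := fun k => by
    induction k with
    | zero => exact fun _ => isUnit_one
    | succ k ih =>
      intro hk
      refine (ih (by omega)).mul ?_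
      rw [tSeq, dif_pos (by omega)]
      exact isUnit_T ξ κ _
  have h2 := haS (e Z n 0 1)
  rw [h0, map_zero, toAlg_e hx' ι (Nat.zero_le n), Algebra.TensorProduct.one_def, sandwich_tmul,
    map_one, map_one, desc, one_mul, one_mul, mul_one] at h2
  exact (hu n le_rfl).mul_left_eq_zero.mp h2.symm

/-- H_1 embeds in Z[y]/(f), a free module over a domain, with evaluation at L_1 as a left inverse.
-/
theorem smul_eq_zero_one [IsDomain Z] {c : Z} (hc : c ≠ 0) (a : CyclotomicHecke 1 ξ κ)
    (ha : c • a = 0) : a = 0 := by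
  let f := cycPoly ξ κ
  have hf : f.Monic := cycPoly_monic ξ κ
  have := hf.free_adjoinRoot
  have hsys : IsHeckeSystem ξ 1 (AdjoinRoot.root f) fun _ => (0 : AdjoinRoot f) :=
    { quad := fun r hr => by omega
      far := fun r s hr hs => by omega
      braid := fun r hr => by omega
      x_t := fun r h0 hr => by omega
      x_y := fun hn => by omega }
  obtain ⟨Φ, hΦL, -⟩ := exists_lift (n := 1) ξ κ hsys
    (by rw [AdjoinRoot.aeval_eq, AdjoinRoot.mk_self])
  have hx := aeval_L_zero (n := 1) ξ κ
  have hcomp : (evalRoot hx).comp Φ = AlgHom.id Z _ := algHom_ext ξ κ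
    (by rw [AlgHom.comp_apply, hΦL, evalRoot_root]; rfl) fun r => r.elim0
  have h0 : Φ a = 0 := by
    have h1 : c • Φ a = 0 := by rw [← map_smul, ha, map_zero]
    exact (smul_eq_zero.mp h1).resolve_left hc
  have h2 := AlgHom.congr_fun hcomp a
  rw [AlgHom.comp_apply, h0, map_zero] at h2
  exact h2.symm

/-- The cyclotomic Hecke algebra over a domain is torsion free. -/
theorem smul_eq_zero_imp [IsDomain Z] (n : ℕ) [NeZero n] {c : Z} (hc : c ≠ 0)
    (a : CyclotomicHecke n ξ κ) (ha : c • a = 0) : a = 0 := by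
  have H : ∀ m, ∀ a : CyclotomicHecke (m + 1) ξ κ, c • a = 0 → a = 0 := fun m => by
    induction m with
    | zero => exact smul_eq_zero_one ξ κ hc
    | succ m ih => exact smul_eq_zero_succ ξ κ ih
  obtain ⟨m, rfl⟩ : ∃ m, n = m + 1 := Nat.exists_eq_succ_of_ne_zero (NeZero.ne n)
  exact H m a ha

end CyclotomicHecke

/-! ### The hash images satisfy the relations. -/

theorem zpow_mul_quantumInt_neg {Z : Type*} [CommRing Z] (ξ : Zˣ) (k : ℤ) :
    ((ξ ^ k : Zˣ) : Z) * quantumInt ξ (-k) = -quantumInt ξ k := by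
  have hsucc : ∀ m : ℕ, ((ξ ^ (m + 1) : Zˣ) : Z) * quantumInt ξ (Int.negSucc m)
      = -quantumInt ξ (Int.ofNat (m + 1)) := fun m => by
    rw [quantumInt, quantumInt, mul_neg, Finset.mul_sum,
      ← Finset.sum_flip fun j => (ξ : Z) ^ j]
    refine congrArg _ (Finset.sum_congr rfl fun j hj => ?_)
    have hj' : j ≤ m := Nat.lt_succ_iff.mp (Finset.mem_range.mp hj)
    rw [← Units.val_pow_eq_pow_val, ← Units.val_pow_eq_pow_val, ← Units.val_mul, inv_pow,
      ← pow_sub _ (by omega : j + 1 ≤ m + 1), Nat.add_sub_add_right]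
  rcases k with (_ | m) | m
  · simp [quantumInt]
  · exact hsucc m
  · have h := hsucc m
    rw [Int.neg_negSucc, zpow_negSucc]
    change _ * quantumInt ξ (Int.ofNat (m + 1)) = _
    rw [← neg_eq_iff_eq_neg.mpr h, mul_neg, ← mul_assoc, Units.inv_mul, one_mul]

namespace IsHeckeSystem

variable {Z A : Type*} [CommRing Z] [Ring A] [Algebra Z A] {ξ : Zˣ} {n : ℕ} {x : A} {t : ℕ → A}

/-- The images of `x` and the `t r` under the hash map again satisfy the relations. -/
theorem hash (h : IsHeckeSystem ξ n x t) (u : Aˣ) (hu : (u : A) = ((ξ : Z) - 1) • x + 1) :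
    IsHeckeSystem ξ n (-(x * (u⁻¹ : Aˣ))) (fun r => ((ξ : Z) - 1) • 1 - t r) := by
  have hcu : ∀ a : A, Commute a x → Commute a (-(x * (u⁻¹ : Aˣ))) := fun a ha => by
    have : Commute a (u : A) := by
      rw [hu]
      exact (ha.smul_right _).add_right (Commute.one_right a)
    exact (ha.mul_right this.units_inv_right).neg_right
  have hct : ∀ a b : A, Commute a b → Commute a (((ξ : Z) - 1) • 1 - b) := fun a b hab =>
    ((Commute.one_right a).smul_right _).sub_right hab
  refine ⟨fun r hr => ?_, fun r s hr hs => ?_, fun r hr => ?_, fun r h0 hr => ?_, fun hn => ?_⟩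
  · simp only [mul_sub, sub_mul, smul_mul_assoc, mul_smul_comm, one_mul, mul_one, h.quad r hr]
    module
  · exact hct _ _ (hct _ _ (h.far r s hr hs).symm).symm
  · have ha := h.quad r (by omega)
    have hb := h.quad (r + 1) (by omega)
    have hab := h.braid r hr
    simp only [mul_sub, sub_mul, smul_mul_assoc, mul_smul_comm, one_mul, mul_one, hab, ha, hb]
    module
  · exact hct _ _ (hcu _ (h.x_t r h0 hr).symm).symm
  · have hq := h.quad 0 hn
    have hxY : Commute (t 0 * x * t 0 + t 0) x := (h.x_y hn).symm
    set τ := t 0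
    set s := (ξ : Z) - 1 with hs
    set w : A := ((u⁻¹ : Aˣ) : A)
    have hwu : w * u = 1 := Units.inv_mul u
    have hτ : (s • 1 - τ) * τ = -((ξ : Z) • (1 : A)) := by
      rw [sub_mul, hq, smul_mul_assoc, one_mul]
      abel
    have hτ' : τ * (s • 1 - τ) = -((ξ : Z) • (1 : A)) := by
      rw [mul_sub, hq, mul_smul_comm, mul_one]
      abel
    have hτu : IsUnit τ := by
      refine isUnit_iff_exists.mpr ⟨((ξ⁻¹ : Zˣ) : Z) • (τ - s • 1), ?_, ?_⟩
      · rw [mul_smul_comm, ← neg_sub, mul_neg, hτ', neg_neg, smul_smul, Units.inv_mul, one_smul]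
      · rw [smul_mul_assoc, ← neg_sub, neg_mul, hτ, neg_neg, smul_smul, Units.inv_mul, one_smul]
    -- With Y = τ x τ + τ, this reads τ u τ = (ξ - 1) Y + ξ: a unit commuting with x. By `hE`, the
    -- hash image of Y is -ξ Y (τ u τ)⁻¹, so it commutes with x and hence with -x u⁻¹.
    have hv : τ * u * τ = s • (τ * x * τ + τ) + (ξ : Z) • 1 := by
      simp only [hu, mul_add, add_mul, mul_smul_comm, smul_mul_assoc, mul_one, hq]
      module
    have hvu : IsUnit (τ * u * τ) := (hτu.mul u.isUnit).mul hτu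
    have hvx : Commute (τ * u * τ) x := by
      rw [hv]
      exact (hxY.smul_left _).add_left ((Commute.one_left x).smul_left _)
    have hE : ((s • 1 - τ) * -(x * w) * (s • 1 - τ) + (s • 1 - τ)) * (τ * u * τ)
        = -((ξ : Z) • (τ * x * τ + τ)) := by
      have e : ∀ σ : A, (σ * -(x * w) * σ + σ) * (τ * u * τ)
          = -(σ * x * w * (σ * τ) * u * τ) + σ * τ * u * τ := fun σ => by noncomm_ring
      have e2 : (s • 1 - τ) * x * w * u = (s • 1 - τ) * x := by rw [mul_assoc, hwu, mul_one]
      rw [e, hτ]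
      simp only [mul_neg, neg_mul, mul_smul_comm, smul_mul_assoc, mul_one, one_mul, e2]
      rw [hu]
      simp only [sub_mul, add_mul, smul_mul_assoc, one_mul]
      module
    refine hvu.mul_right_cancel ?_
    rw [mul_assoc, hE, mul_assoc _ (-(x * w)), ← (hcu _ hvx).eq, ← mul_assoc, hE]
    exact ((hcu _ hxY).smul_left _).neg_left.symm.eq

end IsHeckeSystem

namespace CyclotomicHecke

section

variable {Z A : Type*} [CommRing Z] [Ring A] [Algebra Z A] {ξ : Zˣ} {x : A}

/-- Factor by factor, (-x u⁻¹ - [k]) u = -ξ^k (x - [-k]), because (ξ - 1)[k] = ξ^k - 1 and ξ^k [-k]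
= -[k]. This is where the multicharge gets negated. -/
theorem exists_prod_hash (u : Aˣ) (hu : (u : A) = ((ξ : Z) - 1) • x + 1) (ks : List ℤ) :
    ∃ c : Z, (ks.map fun k => -(x * (u⁻¹ : Aˣ)) - algebraMap Z A (quantumInt ξ k)).prod
        * (u : A) ^ ks.length
      = c • Polynomial.aeval x
        (ks.map fun k => Polynomial.X - Polynomial.C (quantumInt ξ (-k))).prod := by
  induction ks with
  | nil => exact ⟨1, by simp⟩
  | cons k ks ih =>
    obtain ⟨c, hc⟩ := ih
    refine ⟨c * -((ξ ^ k : Zˣ) : Z), ?_⟩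
    rw [List.map_cons, List.prod_cons, List.length_cons, pow_succ, ← mul_assoc, mul_assoc (_ - _),
      hc, List.map_cons, List.prod_cons, map_mul]
    set P := Polynomial.aeval x
      (ks.map fun k => Polynomial.X - Polynomial.C (quantumInt ξ (-k))).prod with hP
    have hPu : P * u = u * P := by
      refine (commute_aeval (Commute.symm ?_) _).symm
      rw [hu]
      exact ((Commute.refl x).smul_right _).add_right (Commute.one_right x)
    have h1 : (-(x * (u⁻¹ : Aˣ)) - algebraMap Z A (quantumInt ξ k)) * (u : A)
        = -((ξ ^ k : Zˣ) : Z) • (x - algebraMap Z A (quantumInt ξ (-k))) := by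
      have h2 := sub_one_mul_quantumInt ξ k
      have h3 := zpow_mul_quantumInt_neg ξ k
      rw [sub_mul, neg_mul, mul_assoc, Units.inv_mul, mul_one, ← Algebra.smul_def, hu,
        Algebra.algebraMap_eq_smul_one, smul_sub, smul_smul, smul_add, smul_smul,
        neg_mul, h3, neg_neg, mul_comm (quantumInt ξ k), h2]
      module
    rw [mul_assoc, smul_mul_assoc, hPu, mul_smul_comm, ← mul_assoc, h1, smul_mul_assoc, smul_smul,
      map_sub, Polynomial.aeval_X, Polynomial.aeval_C]

theorem aeval_hash {l : ℕ} {κ : Fin l → ℤ} (u : Aˣ) (hu : (u : A) = ((ξ : Z) - 1) • x + 1)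
    (hx : (cycPoly ξ (dualMulticharge κ)).aeval x = 0) :
    (cycPoly ξ κ).aeval (-(x * (u⁻¹ : Aˣ))) = 0 := by
  obtain ⟨c, hc⟩ := exists_prod_hash u hu (List.ofFn κ)
  have e : ((List.ofFn κ).map fun k => Polynomial.X - Polynomial.C (quantumInt ξ (-k))).prod
      = cycPoly ξ (dualMulticharge κ) := by
    rw [cycPoly, List.map_ofFn, List.prod_ofFn, List.prod_ofFn]
    exact (Equiv.prod_comp Fin.revPerm fun i =>
      Polynomial.X - Polynomial.C (quantumInt ξ (-κ i))).symm
  rw [e, hx, smul_zero, List.map_ofFn] at hc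
  rw [aeval_cycPoly]
  exact ((u.isUnit.pow _).mul_left_eq_zero).mp hc

end

/-! ### Existence, uniqueness and involutivity. -/

variable {Z : Type*} [CommRing Z] {n : ℕ} [NeZero n] {l : ℕ} {ξ : Zˣ} {κ μ : Fin l → ℤ}

theorem val_unitAffineL₁ : ((unitAffineL₁ ξ κ : (CyclotomicHecke n ξ κ)ˣ) : CyclotomicHecke n ξ κ)
    = ((ξ : Z) - 1) • L ξ κ 0 + 1 :=
  rfl

theorem neg_smul_inv_T (r : Fin (n - 1)) :
    -((ξ : Z) • (((unitT ξ κ r)⁻¹ : (CyclotomicHecke n ξ κ)ˣ) : CyclotomicHecke n ξ κ))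
      = ((ξ : Z) - 1) • 1 - T ξ κ r := by
  have h : (unitT ξ κ r : CyclotomicHecke n ξ κ) = T ξ κ r := rfl
  refine (unitT ξ κ r).isUnit.mul_right_cancel ?_
  rw [neg_mul, smul_mul_assoc, Units.inv_mul, sub_mul, h, T_mul_self, smul_mul_assoc, one_mul]
  abel

theorem exists_hash (κ : Fin l → ℤ) :
    ∃ φ : CyclotomicHecke n ξ κ →ₐ[Z] CyclotomicHecke n ξ (dualMulticharge κ), IsHash φ ∧
      φ (L ξ κ 0) = -(L ξ (dualMulticharge κ) (0 : Fin n) *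
        (((unitAffineL₁ ξ (dualMulticharge κ))⁻¹ : (CyclotomicHecke n ξ (dualMulticharge κ))ˣ) :
          CyclotomicHecke n ξ (dualMulticharge κ))) := by
  set u : (CyclotomicHecke n ξ (dualMulticharge κ))ˣ := unitAffineL₁ ξ (dualMulticharge κ)
  have hu : (u : CyclotomicHecke n ξ (dualMulticharge κ))
    = ((ξ : Z) - 1) • L ξ (dualMulticharge κ) 0 + 1 := val_unitAffineL₁
  obtain ⟨φ, hL, hT⟩ := exists_lift (n := n) ξ κ
    ((isHeckeSystem n ξ (dualMulticharge κ)).hash u hu) (aeval_hash u hu (aeval_L_zero _ _))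
  refine ⟨φ, ⟨fun r => ?_, fun h1 => ?_, fun _ => ?_⟩, hL⟩
  · rw [hT, neg_smul_inv_T, tSeq_val]
  · have : u = 1 := by
      ext
      rw [hu, h1, Units.val_one, sub_self, zero_smul, zero_add, Units.val_one]
    rw [hL, this, inv_one, Units.val_one, mul_one]
  · refine u.isUnit.mul_left_cancel ?_
    have hc : Commute (u : CyclotomicHecke n ξ (dualMulticharge κ)) (L ξ (dualMulticharge κ) 0) := by
      rw [hu]
      exact ((Commute.refl _).smul_left _).add_left (Commute.one_left _)
    rw [affineL₁, map_add, map_smul, map_one, hL, mul_add, mul_smul_comm, mul_neg, ← mul_assoc,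
      hc.eq, mul_assoc, Units.mul_inv, mul_one, mul_one, hu]
    module

/-- For ξ ≠ 1 the condition on u only equates (ξ - 1) times the two images of L_1; torsion-freeness
of the target cancels the factor. -/
theorem IsHash.unique [IsDomain Z] {f g : CyclotomicHecke n ξ κ →ₐ[Z] CyclotomicHecke n ξ μ}
    (hf : IsHash f) (hg : IsHash g) : f = g := by
  refine algHom_ext ξ κ ?_ fun r => (hf.map_T r).trans (hg.map_T r).symm
  by_cases h1 : ξ = 1
  · exact (hf.map_L₁ h1).trans (hg.map_L₁ h1).symm
  · have h := (hf.map_affineL₁ h1).trans (hg.map_affineL₁ h1).symm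
    have hc : (ξ : Z) - 1 ≠ 0 := fun h0 => h1 (Units.ext (sub_eq_zero.mp h0))
    rw [affineL₁, map_add, map_add, map_smul, map_smul, map_one, map_one] at h
    refine sub_eq_zero.mp (smul_eq_zero_imp ξ μ n hc _ ?_)
    rw [smul_sub, add_right_cancel h, sub_self]

theorem congr_T (h : κ = μ) (r : Fin (n - 1)) : congr h (T ξ κ r) = T ξ μ r := by
  subst h
  rfl

theorem congr_L (h : κ = μ) (k : Fin n) : congr h (L ξ κ k) = L ξ μ k := by
  subst h
  rfl

theorem congr_inv_affineL₁ (h : κ = μ) :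
    congr h (((unitAffineL₁ ξ κ)⁻¹ : (CyclotomicHecke n ξ κ)ˣ) : CyclotomicHecke n ξ κ)
      = ((unitAffineL₁ ξ μ)⁻¹ : (CyclotomicHecke n ξ μ)ˣ) := by
  subst h
  rfl

end CyclotomicHecke

theorem mainTheorem3 {Z : Type*} [CommRing Z] [IsDomain Z] (n : ℕ) [NeZero n] (l : ℕ) (ξ : Zˣ)
    (κ : Fin l → ℤ) :
    ∃ hash : CyclotomicHecke n ξ κ →ₐ[Z] CyclotomicHecke n ξ (dualMulticharge κ),
      CyclotomicHecke.IsHash hash ∧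
      (∀ g : CyclotomicHecke n ξ κ →ₐ[Z] CyclotomicHecke n ξ (dualMulticharge κ),
        CyclotomicHecke.IsHash g → g = hash) ∧
      (∀ h : dualMulticharge κ = κ,
        Function.Involutive fun x : CyclotomicHecke n ξ κ =>
          CyclotomicHecke.congr h (hash x)) := by
  obtain ⟨φ, hφ, hL⟩ := CyclotomicHecke.exists_hash (n := n) (ξ := ξ) κ
  refine ⟨φ, hφ, fun g hg => hg.unique hφ, fun h => ?_⟩
  let F : CyclotomicHecke n ξ κ →ₐ[Z] CyclotomicHecke n ξ κ :=
    (CyclotomicHecke.congr h).toAlgHom.comp φ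
  have hF : ∀ a, F a = CyclotomicHecke.congr h (φ a) := fun _ => rfl
  set u : (CyclotomicHecke n ξ κ)ˣ := CyclotomicHecke.unitAffineL₁ ξ κ
  have hu : (u : CyclotomicHecke n ξ κ) = ((ξ : Z) - 1) • CyclotomicHecke.L ξ κ 0 + 1 := rfl
  have hFT : ∀ r, F (CyclotomicHecke.T ξ κ r)
      = ((ξ : Z) - 1) • 1 - CyclotomicHecke.T ξ κ r := fun r => by
    rw [hF, hφ.map_T, CyclotomicHecke.neg_smul_inv_T, map_sub, map_smul, map_one,
      CyclotomicHecke.congr_T]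
  have hFL : F (CyclotomicHecke.L ξ κ 0)
      = -(CyclotomicHecke.L ξ κ (0 : Fin n) * (u⁻¹ : (CyclotomicHecke n ξ κ)ˣ)) := by
    rw [hF, hL, map_neg, map_mul, CyclotomicHecke.congr_L, CyclotomicHecke.congr_inv_affineL₁]
  -- Indeed (ξ - 1)(-L_1 u⁻¹) + 1 = (u - (ξ - 1) L_1) u⁻¹ = u⁻¹. Then F² sends L_1 to L_1 u⁻¹ u =
  -- L_1.
  have hFu : F (u : CyclotomicHecke n ξ κ) = (u⁻¹ : (CyclotomicHecke n ξ κ)ˣ) := by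
    refine u.isUnit.mul_right_cancel ?_
    rw [hu, map_add, map_smul, map_one, hFL, ← hu, Units.inv_mul, add_mul, smul_mul_assoc,
      neg_mul, mul_assoc, Units.inv_mul, mul_one, one_mul, hu]
    module
  have hFu' : F (u⁻¹ : (CyclotomicHecke n ξ κ)ˣ) = u := by
    have h1 : F (u : CyclotomicHecke n ξ κ) * F (u⁻¹ : (CyclotomicHecke n ξ κ)ˣ) = 1 := by
      rw [← map_mul, Units.mul_inv, map_one]
    rw [hFu] at h1
    exact ((Units.inv_mul_eq_one).mp h1).symm
  have hFF : F.comp F = AlgHom.id Z _ := by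
    refine CyclotomicHecke.algHom_ext ξ κ ?_ fun r => ?_
    · rw [AlgHom.comp_apply, hFL, map_neg, map_mul, hFL, hFu', neg_mul, neg_neg, mul_assoc,
        Units.inv_mul, mul_one, AlgHom.id_apply]
    · rw [AlgHom.comp_apply, hFT, map_sub, map_smul, map_one, hFT, sub_sub_cancel, AlgHom.id_apply]
  exact fun a => AlgHom.congr_fun hFF a
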